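/- Let $n\ge 3$ and let $\Delta(n;1,1,1)$ be the graph with vertices $v_{x,y}$, $x\in\{1,2,3\}$, $y\in\mathbb{Z}/n\mathbb{Z}$, in which each $v_{x,y}$ is joined to $v_{x,y+1}$ and $v_{x,y-1}$, and, for each fixed $y$, the vertices $v_{1,y},v_{2,y},v_{3,y}$ are pairwise joined; it is isomorphic to the Cartesian product $C_3\times C_n$ of two cycles. For a finite connected graph $G$ with vertex set $V$ and Laplacian matrix $L(G)=D(G)-A(G)$, let $\mathrm{Jac}(G)$ be the torsion subgroup of $\mathrm{coker}\,L(G)=\mathbb{Z}^{V}/\mathrm{im}\,L(G)$. Put $U_{s}(x)=\dfrac{\sin((s+1)\arccos x)}{\sin(\arccos x)}$ (the Chebyshev function of the second kind, with $\arccos$ the principal complex branch $-i\log(x+i\sqrt{1-x^2})$), and $$\nu(n)=\begin{cases}U_{n/2-1}(5/2), & n\text{ even},\\ \sqrt7\,U_{n/2-1}(5/2), & n\text{ odd},\end{cases}\qquad \mu(n)=\begin{cases}7,& n\text{ even},\\ 1,& n\text{ odd},\end{cases}\qquad \widehat\mu(n)=\gcd(n,3)\,\mu(n).$$ Then $\nu(n)$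 is a positive integer, $\gcd(n,3)$ divides $\gcd(n,\nu(n))$, and $$\mathrm{Jac}(\Delta(n;1,1,1))\;\cong\;\mathbb{Z}_{\frac{\gcd(n,\nu(n))}{\gcd(n,3)}}\oplus\mathbb{Z}_{\nu(n)}^{2}\oplus\mathbb{Z}_{\widehat\mu(n)\,\nu(n)}\oplus\mathbb{Z}_{3\,\mu(n)\,\mathrm{lcm}(n,\,\nu(n))},$$ where $\mathbb{Z}_m=\mathbb{Z}/m\mathbb{Z}$. -/

import Mathlib

/-- The step `j(1) = k`, `j(2) = l`, `j(3) = m` of the three circulant layers of `Δ(n; k, l, m)`. -/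
def deltaStep (k l m : ℤ) : Fin 3 → ℤ := ![k, l, m]

/-- The `Δ`-graph `Δ(n; k, l, m)`, as a simple graph: vertices `v_{x,y}` with `x` one of three
layers and `y` an integer modulo `n`; `v_{x,y}` is joined to `v_{x,y+j(x)}` (hence also to
`v_{x,y-j(x)}`), and the three vertices with the same `y` form a triangle.  The graph has no loops
or multiple edges exactly when `2k, 2l, 2m` are nonzero modulo `n`; in particular
`Δ(n; 1, 1, 1)` has none for `n ≥ 3`. -/
def deltaGraph (n : ℕ) (k l m : ℤ) : SimpleGraph (Fin 3 × ZMod n) where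
  Adj u v := u ≠ v ∧
    ((u.1 = v.1 ∧ (v.2 = u.2 + (deltaStep k l m u.1 : ZMod n) ∨
        u.2 = v.2 + (deltaStep k l m v.1 : ZMod n))) ∨
      (u.1 ≠ v.1 ∧ u.2 = v.2))
  symm := ⟨by
    rintro u v ⟨h, h' | h'⟩
    · exact ⟨h.symm, Or.inl ⟨h'.1.symm, h'.2.symm⟩⟩
    · exact ⟨h.symm, Or.inr ⟨h'.1.symm, h'.2.symm⟩⟩⟩
  loopless := ⟨fun _ h => h.1 rfl⟩

instance (n : ℕ) (k l m : ℤ) : DecidableRel (deltaGraph n k l m).Adj := fun u v =>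
  inferInstanceAs (Decidable (u ≠ v ∧
    ((u.1 = v.1 ∧ (v.2 = u.2 + (deltaStep k l m u.1 : ZMod n) ∨
        u.2 = v.2 + (deltaStep k l m v.1 : ZMod n))) ∨
      (u.1 ≠ v.1 ∧ u.2 = v.2))))

/-- The cokernel `ℤ^V / im L(G)` of the integer Laplacian `L(G) = D(G) - A(G)` of a graph. -/
abbrev laplacianCoker {V : Type*} [Fintype V] [DecidableEq V] (G : SimpleGraph V)
    [DecidableRel G.Adj] : Type _ :=
  (V → ℤ) ⧸ LinearMap.range (Matrix.mulVecLin (G.lapMatrix ℤ))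

/-- The Jacobian group: the torsion subgroup of the cokernel of the Laplacian. -/
abbrev jacobianGroup {V : Type*} [Fintype V] [DecidableEq V] (G : SimpleGraph V)
    [DecidableRel G.Adj] : AddSubgroup (laplacianCoker G) :=
  AddCommGroup.torsion (laplacianCoker G)

/-- The principal branch of the complex inverse cosine,
`arccos z = -i log (z + i √(1 - z²))`. -/
noncomputable def complexArccos (z : ℂ) : ℂ :=
  -Complex.I * Complex.log (z + Complex.I * (1 - z ^ 2) ^ (1 / 2 : ℂ))

/-- The Chebyshev function of the second kind of arbitrary (not necessarily integer) index,
`U_s(x) = sin ((s + 1) arccos x) / sin (arccos x)`, for `x ≠ ±1`. -/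
noncomputable def chebyshevU (s x : ℂ) : ℂ :=
  Complex.sin ((s + 1) * complexArccos x) / Complex.sin (complexArccos x)

/-- `ν(n) = U_{n/2-1}(5/2)` for even `n` and `√7 · U_{n/2-1}(5/2)` for odd `n`. -/
noncomputable def nuFun (n : ℕ) : ℂ :=
  if Even n then chebyshevU ((n : ℂ) / 2 - 1) (5 / 2)
  else (Real.sqrt 7 : ℂ) * chebyshevU ((n : ℂ) / 2 - 1) (5 / 2)

/-- The `2`-periodic sequence `μ(1), μ(2), μ(3), … = 1, 7, 1, 7, …`. -/
def muSeq (n : ℕ) : ℕ := if Even n then 7 else 1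

/-- `μ̂(n) = gcd(n, 3) μ(n)`. -/
def muHat (n : ℕ) : ℕ := Nat.gcd n 3 * muSeq n

/-! The shift of `y` makes the cokernel a `ℤ[X]`-module. With `Q = X² - 5X + 1` the Laplacian
relation reads `Q v_x = -X (v_0 + v_1 + v_2)`. So `Q` kills differences of layers, summing over `x`
shows that `(X - 1)²` kills `v_0 + v_1 + v_2`, and hence `(X - 1)² Q` kills each `v_x`. As `v_1` is
expressible through the other two, the cokernel is `ℤ[X]/(Q, Xⁿ - 1) ⊕ ℤ[X]/((X - 1)² Q, Xⁿ - 1)`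
(`presentation_surjective`, `presentation_eq_zero`, `mem_ideals_of_presentation_eq_zero`).
Evaluation at 1 splits a `ℤ` off the second summand and leaves `ℤ[X]/((X - 1) Q, 1 + ⋯ + Xⁿ⁻¹)`
(`mem_quarticIdeal_iff`).

Modulo `Q` the geometric sum is a power of the unit `X` times `ν` (`n` odd) or `ν (X + 1)` (`n`
even). This yields explicit bases of both ideals (`exists_lattice_data`). With `ρ = μν` the finite
quotients are `ℤ_ν ⊕ ℤ_{3ρ}` and `ℤ_ν ⊕ ℤ²/⟨(ρ, c), (0, n)⟩`, where `3c + ρ = ±n`; the last factor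
is `ℤ_d ⊕ ℤ_{ρn/d}` with `d = gcd(ρ, c)` (`smith_two`).

It remains to see that `d · gcd(n, 3) = gcd(n, ν)` (`gcd_mul_gcd_three`), which rests on the 3-adic
and 7-adic behaviour of `ν`, and, when `3 ∤ n`, to move a factor 3 between two cyclic summands. -/

/-! ### The sequence `ν`: Binet formula and divisibility by 3 and 7 -/

/-- The integer sequence `ν(n)`, defined by the recursion `ν(n + 4) = 5 ν(n + 2) - ν(n)`. -/
def nuInt : ℕ → ℤ
  | 0 => 0
  | 1 => 1
  | 2 => 1
  | 3 => 6
  | n + 4 => 5 * nuInt (n + 2) - nuInt n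

/-- The larger root `(√7 + √3) / 2` of `x² - √7 x + 1`. -/
noncomputable def bigRoot : ℝ := (√7 + √3) / 2

/-- The smaller root `(√7 - √3) / 2` of `x² - √7 x + 1`. -/
noncomputable def smallRoot : ℝ := (√7 - √3) / 2

/-- The factor by which `ν(n)` differs from the difference of the `n`-th powers of the roots. -/
noncomputable def nuScale (n : ℕ) : ℝ := √3 * if Even n then √7 else 1

/-- The sign `(-1) ^ (n + 1)`. -/
def oddSign (n : ℕ) : ℤ := if Even n then -1 else 1

lemma sq_sqrt_three : √(3 : ℝ) ^ 2 = 3 := Real.sq_sqrt (by norm_num)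

lemma sq_sqrt_seven : √(7 : ℝ) ^ 2 = 7 := Real.sq_sqrt (by norm_num)

lemma bigRoot_mul_smallRoot : bigRoot * smallRoot = 1 := by
  unfold bigRoot smallRoot
  linear_combination (1 / 4) * sq_sqrt_seven - (1 / 4) * sq_sqrt_three

lemma bigRoot_sq : bigRoot ^ 2 = 5 / 2 + √7 * √3 / 2 := by
  unfold bigRoot
  linear_combination (1 / 4) * sq_sqrt_seven + (1 / 4) * sq_sqrt_three

lemma smallRoot_sq : smallRoot ^ 2 = 5 / 2 - √7 * √3 / 2 := by
  unfold smallRoot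
  linear_combination (1 / 4) * sq_sqrt_seven + (1 / 4) * sq_sqrt_three

lemma bigRoot_pow_four : bigRoot ^ 4 = 5 * bigRoot ^ 2 - 1 := by
  have h : bigRoot ^ 2 + smallRoot ^ 2 = 5 := by rw [bigRoot_sq, smallRoot_sq]; ring
  linear_combination bigRoot ^ 2 * h - (bigRoot * smallRoot + 1) * bigRoot_mul_smallRoot

lemma smallRoot_pow_four : smallRoot ^ 4 = 5 * smallRoot ^ 2 - 1 := by
  have h : bigRoot ^ 2 + smallRoot ^ 2 = 5 := by rw [bigRoot_sq, smallRoot_sq]; ring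
  linear_combination smallRoot ^ 2 * h - (bigRoot * smallRoot + 1) * bigRoot_mul_smallRoot

lemma nuScale_pos (n : ℕ) : 0 < nuScale n := by
  unfold nuScale; split_ifs <;> positivity

lemma nuScale_sq (n : ℕ) : nuScale n ^ 2 = 3 * muSeq n := by
  unfold nuScale muSeq
  split_ifs <;> rw [mul_pow, sq_sqrt_three]
  · rw [sq_sqrt_seven]; norm_num
  · norm_num

/-- The squares of the two roots are the roots of `t² - 5t + 1`, so both sides obey the same
step-two recursion; the scale depends only on parity. -/
lemma nuScale_mul_nuInt : ∀ n : ℕ, nuScale n * nuInt n = bigRoot ^ n - smallRoot ^ n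
  | 0 => by simp [nuInt]
  | 1 => by simp [nuInt, nuScale, bigRoot, smallRoot]; ring
  | 2 => by
      rw [bigRoot_sq, smallRoot_sq]; simp [nuInt, nuScale]; ring
  | 3 => by
      rw [pow_succ bigRoot 2, pow_succ smallRoot 2, bigRoot_sq, smallRoot_sq]
      have : ¬ Even 3 := by decide
      simp only [nuInt, nuScale, bigRoot, smallRoot, this, if_false]
      push_cast
      linear_combination (- √3 / 2) * sq_sqrt_seven
  | n + 4 => by
      have h1 := nuScale_mul_nuInt n
      have h2 := nuScale_mul_nuInt (n + 2)
      have e2 : nuScale (n + 2) = nuScale n := by simp [nuScale, Nat.even_add]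
      have e4 : nuScale (n + 4) = nuScale n := by
        have : Even 4 := by decide
        simp [nuScale, Nat.even_add, this]
      rw [e2] at h2
      rw [e4, nuInt]
      push_cast
      linear_combination 5 * h2 - h1 - bigRoot ^ n * bigRoot_pow_four
        + smallRoot ^ n * smallRoot_pow_four

lemma nuScale_odd_mul {k : ℕ} (hk : Odd k) (n : ℕ) : nuScale (k * n) = nuScale n := by
  have : ¬ Even k := Nat.not_even_iff_odd.2 hk
  simp [nuScale, Nat.even_mul, this]

lemma oddSign_odd_mul {k : ℕ} (hk : Odd k) (n : ℕ) : oddSign (k * n) = oddSign n := by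
  have : ¬ Even k := Nat.not_even_iff_odd.2 hk
  simp [oddSign, Nat.even_mul, this]

/-- Binet formula and `x³ - y³ = (x - y)³ + 3xy(x - y)` with `xy = 1`. -/
lemma nuInt_three_mul (n : ℕ) :
    nuInt (3 * n) = 3 * (nuInt n * (muSeq n * nuInt n ^ 2 + 1)) := by
  have h1 := nuScale_mul_nuInt n
  have h3 := nuScale_mul_nuInt (3 * n)
  have hxy : bigRoot ^ n * smallRoot ^ n = 1 := by
    rw [← mul_pow, bigRoot_mul_smallRoot, one_pow]
  have hs := nuScale_sq n
  rw [nuScale_odd_mul (by decide), mul_comm 3 n, pow_mul, pow_mul, mul_comm n 3] at h3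
  generalize bigRoot ^ n = x at *
  generalize smallRoot ^ n = y at *
  have key : (nuInt (3 * n) : ℝ) = 3 * (nuInt n * (muSeq n * nuInt n ^ 2 + 1)) := by
    apply mul_left_cancel₀ (nuScale_pos n).ne'
    have hx : x = nuScale n * nuInt n + y := by linarith
    subst hx
    linear_combination h3 + 3 * nuScale n * nuInt n * hxy + nuScale n * nuInt n ^ 3 * hs
  exact_mod_cast key

/-- Write `x⁷ - y⁷` through `x - y` with `xy = 1`; for even `n`, `(x - y)² = 21 ν²` supplies the
missing factor 7 in the leading term. -/
lemma seven_mul_nuInt_dvd {n : ℕ} (hn : Even n) : 7 * nuInt n ∣ nuInt (7 * n) := by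
  have h1 := nuScale_mul_nuInt n
  have h3 := nuScale_mul_nuInt (7 * n)
  have hxy : bigRoot ^ n * smallRoot ^ n = 1 := by
    rw [← mul_pow, bigRoot_mul_smallRoot, one_pow]
  have hs := nuScale_sq n
  have hm : muSeq n = 7 := by simp [muSeq, hn]
  rw [nuScale_odd_mul (by decide), mul_comm 7 n, pow_mul, pow_mul, mul_comm n 7] at h3
  rw [hm] at hs
  push_cast at hs
  generalize bigRoot ^ n = x at *
  generalize smallRoot ^ n = y at *
  have key : (nuInt (7 * n) : ℝ) =
      7 * nuInt n * (3 ^ 3 * 7 ^ 2 * nuInt n ^ 6 + 9 * 7 ^ 2 * nuInt n ^ 4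
        + 42 * nuInt n ^ 2 + 1) := by
    apply mul_left_cancel₀ (nuScale_pos n).ne'
    have h7 : x ^ 7 - y ^ 7 = (x - y) * ((x - y) ^ 6 + 7 * (x * y) * (x - y) ^ 4
      + 14 * (x * y) ^ 2 * (x - y) ^ 2 + 7 * (x * y) ^ 3) := by ring
    rw [h3, h7, hxy, ← h1]
    have h4 : nuScale n ^ 4 = 441 := by
      rw [show nuScale n ^ 4 = (nuScale n ^ 2) ^ 2 by ring, hs]; norm_num
    have h6 : nuScale n ^ 6 = 9261 := by
      rw [show nuScale n ^ 6 = (nuScale n ^ 2) ^ 3 by ring, hs]; norm_num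
    simp only [mul_pow, hs, h4, h6]
    ring
  exact ⟨_, by exact_mod_cast key⟩

lemma nuInt_pos_lt : ∀ n : ℕ, 0 ≤ nuInt n ∧ nuInt n < nuInt (n + 2)
  | 0 => by simp [nuInt]
  | 1 => by simp [nuInt]
  | n + 2 => by
      have := nuInt_pos_lt n
      rw [nuInt]
      omega

lemma nuInt_pos {n : ℕ} (hn : 0 < n) : 0 < nuInt n := by
  match n, hn with
  | 1, _ => simp [nuInt]
  | n + 2, _ => have := nuInt_pos_lt n; omega

lemma three_dvd_oddSign_mul_sub_nuInt : ∀ n : ℕ, (3 : ℤ) ∣ oddSign n * n - nuInt n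
  | 0 => by simp [nuInt]
  | 1 => by simp [nuInt, oddSign]
  | 2 => by norm_num [nuInt, oddSign]
  | 3 => by
      have : ¬ Even 3 := by decide
      norm_num [nuInt, oddSign, this]
  | n + 4 => by
      have h1 := three_dvd_oddSign_mul_sub_nuInt n
      have h2 := three_dvd_oddSign_mul_sub_nuInt (n + 2)
      have h4 : Even 4 := by decide
      rw [nuInt]
      simp only [oddSign, Nat.even_add, even_two, h4, iff_true] at *
      push_cast at *
      split_ifs at * <;> omega

lemma seven_pow_dvd_nuInt {n : ℕ} (hn : Even n) (k : ℕ) :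
    (7 : ℤ) ^ k ∣ nuInt (7 ^ k * n) := by
  induction k with
  | zero => simp
  | succ k ih =>
    rw [pow_succ', pow_succ', mul_assoc]
    exact (mul_dvd_mul_left 7 ih).trans (seven_mul_nuInt_dvd (hn.mul_left _))

/-- Tripling multiplies `ν` by `3 (μν² + 1)`. Since `μ ≡ 1 (mod 3)`, the bracket is 2 modulo 3 the
first time, when `3 ∤ ν`, and 1 afterwards. -/
lemma nuInt_three_pow (m k : ℕ) (hm : ¬ 3 ∣ m) :
    ∃ t : ℤ, nuInt (3 ^ (k + 1) * m) = 3 ^ (k + 1) * t ∧ (3 : ℤ) ∣ t - 2 * (oddSign m * m) := by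
  have hmu (n : ℕ) : ∃ a : ℤ, (muSeq n : ℤ) = 3 * a + 1 := by
    unfold muSeq; split_ifs
    · exact ⟨2, by norm_num⟩
    · exact ⟨0, by norm_num⟩
  induction k with
  | zero =>
    obtain ⟨a, ha⟩ := hmu m
    refine ⟨nuInt m * (muSeq m * nuInt m ^ 2 + 1), by simp [nuInt_three_mul], ?_⟩
    obtain ⟨b, hb⟩ := three_dvd_oddSign_mul_sub_nuInt m
    have hv : oddSign m * m = nuInt m + 3 * b := by linarith
    have h3 : ¬ (3 : ℤ) ∣ nuInt m := by
      intro h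
      have : (3 : ℤ) ∣ oddSign m * m := by rw [hv]; exact dvd_add h ⟨b, rfl⟩
      unfold oddSign at this
      split_ifs at this <;> omega
    have hsq : (3 : ℤ) ∣ nuInt m ^ 2 - 1 := by
      have : nuInt m % 3 = 1 ∨ nuInt m % 3 = 2 := by omega
      rcases this with h | h
      · obtain ⟨q, hq⟩ : ∃ q, nuInt m = 3 * q + 1 := ⟨nuInt m / 3, by omega⟩
        exact ⟨3 * q ^ 2 + 2 * q, by rw [hq]; ring⟩
      · obtain ⟨q, hq⟩ : ∃ q, nuInt m = 3 * q + 2 := ⟨nuInt m / 3, by omega⟩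
        exact ⟨3 * q ^ 2 + 4 * q + 1, by rw [hq]; ring⟩
    obtain ⟨q, hq⟩ := hsq
    rw [hv, ha]
    exact ⟨nuInt m * (a * nuInt m ^ 2 + q) - 2 * b, by linear_combination nuInt m * hq⟩
  | succ k ih =>
    obtain ⟨t, ht, b, hb⟩ := ih
    rw [pow_succ', mul_assoc, nuInt_three_mul, ht]
    refine ⟨t * (muSeq (3 ^ (k + 1) * m) * (3 ^ (k + 1) * t) ^ 2 + 1), by ring, ?_⟩
    exact ⟨b + t * (muSeq (3 ^ (k + 1) * m) * 3 * (3 ^ k * t) ^ 2), by linear_combination hb⟩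

/-! ### Identification of `ν` with the Chebyshev values -/

/-- The principal arc cosine of `5 / 2`. -/
lemma complexArccos_five_halves :
    complexArccos (5 / 2) = 2 * Real.log bigRoot * Complex.I := by
  have hb : 0 < bigRoot := by unfold bigRoot; positivity
  have hs : smallRoot = bigRoot⁻¹ := eq_inv_of_mul_eq_one_right bigRoot_mul_smallRoot
  have h1 : (1 - (5 / 2 : ℂ) ^ 2) ^ (1 / 2 : ℂ) = ((√7 * √3 / 2 : ℝ) : ℂ) * Complex.I := by
    have e2 : (√7 * √3 / 2 : ℝ) = (21 / 4 : ℝ) ^ (1 / 2 : ℝ) := by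
      rw [← Real.sqrt_eq_rpow, eq_comm, Real.sqrt_eq_iff_mul_self_eq_of_pos (by positivity)]
      linear_combination (1 / 4) * √3 ^ 2 * sq_sqrt_seven + (7 / 4) * sq_sqrt_three
    rw [show (1 - (5 / 2 : ℂ) ^ 2) = ((-(21 / 4) : ℝ) : ℂ) by push_cast; norm_num,
      Complex.ofReal_cpow_of_nonpos (by norm_num), e2, Complex.ofReal_cpow (by norm_num),
      show (Real.pi : ℂ) * Complex.I * (1 / 2) = Real.pi / 2 * Complex.I by ring,
      Complex.exp_pi_div_two_mul_I]
    push_cast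
    rw [neg_neg]
  -- The principal square root is `+i√21/2`, so the logarithm is taken of the smaller root squared.
  have h2 : (5 / 2 : ℂ) + Complex.I * (1 - (5 / 2) ^ 2) ^ (1 / 2 : ℂ)
      = ((smallRoot ^ 2 : ℝ) : ℂ) := by
    rw [h1, smallRoot_sq]
    push_cast
    linear_combination (√7 * √3 / 2 : ℂ) * Complex.I_sq
  rw [complexArccos, h2, ← Complex.ofReal_log (by positivity), Real.log_pow, hs, Real.log_inv]
  push_cast
  ring

lemma sin_mul_log_bigRoot (n : ℕ) :
    Complex.sin (n * Real.log bigRoot * Complex.I)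
      = ((bigRoot ^ n - smallRoot ^ n : ℝ) : ℂ) / 2 * Complex.I := by
  have hb : 0 < bigRoot := by unfold bigRoot; positivity
  have hs : smallRoot = bigRoot⁻¹ := eq_inv_of_mul_eq_one_right bigRoot_mul_smallRoot
  have : Real.sinh (n * Real.log bigRoot) = (bigRoot ^ n - smallRoot ^ n) / 2 := by
    rw [← Real.log_pow, Real.sinh_log (by positivity), hs, inv_pow]
  rw [Complex.sin_mul_I, ← Complex.ofReal_natCast, ← Complex.ofReal_mul, ← Complex.ofReal_sinh,
    this]
  push_cast
  rfl

lemma nuInt_eq_nuFun (n : ℕ) : (nuInt n : ℂ) = nuFun n := by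
  have hU : chebyshevU ((n : ℂ) / 2 - 1) (5 / 2) = ((nuScale n * nuInt n / (√7 * √3) : ℝ) : ℂ) := by
    have h2 := sin_mul_log_bigRoot 2
    rw [bigRoot_sq, smallRoot_sq] at h2
    rw [chebyshevU, complexArccos_five_halves,
      show ((n : ℂ) / 2 - 1 + 1) * (2 * Real.log bigRoot * Complex.I)
        = n * Real.log bigRoot * Complex.I by ring, sin_mul_log_bigRoot, nuScale_mul_nuInt]
    push_cast at h2
    rw [h2]
    have h7 : (√7 : ℂ) ≠ 0 := by norm_cast; positivity
    have h3 : (√3 : ℂ) ≠ 0 := by norm_cast; positivity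
    have hI := Complex.I_ne_zero
    push_cast
    field_simp
    ring
  have h7 : √7 ≠ 0 := by positivity
  have h3 : √3 ≠ 0 := by positivity
  rw [nuFun, hU]
  split_ifs with h
  · norm_cast
    simp only [nuScale, h, if_true]
    field_simp
  · norm_cast
    simp only [nuScale, h, if_false]
    field_simp

/-! ### Geometric sums modulo `X² - 5X + 1` -/

open Polynomial

/-- The polynomial `X² - 5X + 1`. -/
noncomputable def quadPoly : ℤ[X] := X ^ 2 - 5 * X + 1

/-- The polynomial `1 + X + ⋯ + X ^ (n - 1)`. -/
noncomputable def geomPoly (n : ℕ) : ℤ[X] := ∑ i ∈ Finset.range n, X ^ i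

/-- Modulo `Q`, `X² + 1 ≡ 5X`, so this becomes the recursion of `ν` rescaled by powers of `X`. -/
lemma geomPoly_add_four (n : ℕ) :
    geomPoly (n + 4) = (X ^ 2 + 1) * geomPoly (n + 2) - X ^ 2 * geomPoly n := by
  simp only [geomPoly, Finset.sum_range_succ]
  ring

lemma sub_one_mul_geomPoly (n : ℕ) : (X - 1) * geomPoly n = X ^ n - 1 := by
  rw [geomPoly, mul_comm, geom_sum_mul]

lemma sub_one_dvd_sub_eval (p : ℤ[X]) : (X - 1 : ℤ[X]) ∣ p - ((p.eval 1 : ℤ) : ℤ[X]) := by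
  have := X_sub_C_dvd_sub_C_eval (p := p) (a := 1)
  simpa using this

lemma eval_one_geomPoly (n : ℕ) : (geomPoly n).eval 1 = n := by
  simp [geomPoly, eval_finsetSum]

lemma quadPoly_dvd_geomPoly_odd : ∀ k : ℕ,
    quadPoly ∣ geomPoly (2 * k + 1) - (nuInt (2 * k + 1) : ℤ[X]) * X ^ k
  | 0 => by simp [geomPoly, nuInt]
  | 1 => ⟨1, by simp [geomPoly, nuInt, quadPoly, Finset.sum_range_succ]; ring⟩
  | k + 2 => by
      obtain ⟨a, ha⟩ := quadPoly_dvd_geomPoly_odd k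
      obtain ⟨b, hb⟩ := quadPoly_dvd_geomPoly_odd (k + 1)
      refine ⟨geomPoly (2 * k + 3) + 5 * X * b - X ^ 2 * a, ?_⟩
      rw [show 2 * (k + 2) + 1 = 2 * k + 1 + 4 by ring, geomPoly_add_four, nuInt]
      rw [show 2 * (k + 1) + 1 = 2 * k + 1 + 2 by ring] at hb
      rw [show 2 * k + 3 = 2 * k + 1 + 2 by ring]
      push_cast
      unfold quadPoly at *
      linear_combination 5 * X * hb - X ^ 2 * ha

lemma quadPoly_dvd_geomPoly_even : ∀ k : ℕ,
    quadPoly ∣ geomPoly (2 * k + 2) - (nuInt (2 * k + 2) : ℤ[X]) * (X + 1) * X ^ k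
  | 0 => by simp [geomPoly, nuInt, Finset.sum_range_succ, add_comm]
  | 1 => ⟨X + 1, by simp [geomPoly, nuInt, quadPoly, Finset.sum_range_succ]; ring⟩
  | k + 2 => by
      obtain ⟨a, ha⟩ := quadPoly_dvd_geomPoly_even k
      obtain ⟨b, hb⟩ := quadPoly_dvd_geomPoly_even (k + 1)
      refine ⟨geomPoly (2 * k + 4) + 5 * X * b - X ^ 2 * a, ?_⟩
      rw [show 2 * (k + 2) + 2 = 2 * k + 2 + 4 by ring, geomPoly_add_four, nuInt]
      rw [show 2 * (k + 1) + 2 = 2 * k + 2 + 2 by ring] at hb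
      rw [show 2 * k + 4 = 2 * k + 2 + 2 by ring]
      push_cast
      unfold quadPoly at *
      linear_combination 5 * X * hb - X ^ 2 * ha

lemma X_pow_mul_quadPoly (k : ℕ) :
    (X - 1) * quadPoly ∣ X ^ k * quadPoly - quadPoly := by
  obtain ⟨a, ha⟩ := sub_dvd_pow_sub_pow (X : ℤ[X]) 1 k
  rw [one_pow] at ha
  exact ⟨a, by linear_combination quadPoly * ha⟩

local notation "𝕏" => (X : ℤ[X])

/-- Lifting a congruence modulo `X² - 5X + 1` to one modulo `(X - 1) (X² - 5X + 1)`. -/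
lemma exists_geomPoly_congr {n k : ℕ} {p : ℤ[X]} (h : quadPoly ∣ geomPoly n - p * 𝕏 ^ k) :
    ∃ c : ℤ, (n : ℤ) = p.eval 1 - 3 * c ∧
      (𝕏 - 1) * quadPoly ∣ geomPoly n - 𝕏 ^ k * (p + c * quadPoly) := by
  obtain ⟨q, hq⟩ := h
  refine ⟨q.eval 1, ?_, ?_⟩
  · have := congrArg (eval 1) hq
    simp [quadPoly, eval_one_geomPoly] at this
    linarith
  · obtain ⟨a, ha⟩ := sub_one_dvd_sub_eval q
    obtain ⟨b, hb⟩ := X_pow_mul_quadPoly k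
    exact ⟨a - (q.eval 1 : ℤ) * b, by
      linear_combination hq + quadPoly * ha - (q.eval 1 : ℤ) * hb⟩

/-! ### The ideals as explicit lattices -/

lemma mul_mem_of_X_mul_mem {P : ℤ[X] → Prop} (hadd : ∀ p q, P p → P q → P (p + q))
    (hint : ∀ (a : ℤ) p, P p → P (a * p)) (hX : ∀ p, P p → P (𝕏 * p)) (q p : ℤ[X]) (hp : P p) :
    P (q * p) := by
  induction q using Polynomial.induction_on with
  | C a => simpa using hint a p hp
  | add r s hr hs => rw [add_mul]; exact hadd _ _ hr hs
  | monomial k a ih =>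
    have := hX _ ih
    rwa [show C a * 𝕏 ^ (k + 1) * p = 𝕏 * (C a * 𝕏 ^ k * p) by ring]

/-- Membership in the lattice of polynomials spanned, modulo `X² - 5X + 1`, by `ν (1 + 8X)` and
`3 ρ X`. -/
def InQuadLattice (ν ρ : ℤ) (p : ℤ[X]) : Prop :=
  ∃ (s : ℤ[X]) (x y : ℤ), p = quadPoly * s + ν * x * (1 + 8 * 𝕏) + 3 * ρ * y * 𝕏

/-- Membership in the lattice of polynomials spanned, modulo `(X - 1) (X² - 5X + 1)`, by three
polynomials of degree at most two. -/
def InCubicLattice (ν ρ c n : ℤ) (p : ℤ[X]) : Prop :=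
  ∃ (s : ℤ[X]) (x t z : ℤ), p = (𝕏 - 1) * quadPoly * s + ν * x * (quadPoly + 5 * 𝕏 - 2)
    + t * (ρ * (1 - 2 * 𝕏) + c * quadPoly) + n * z * quadPoly

lemma InQuadLattice.mul {ν ρ μ e : ℤ} (hρ : ρ = μ * ν) (he : μ * e = 7) (q p : ℤ[X])
    (hp : InQuadLattice ν ρ p) : InQuadLattice ν ρ (q * p) := by
  refine mul_mem_of_X_mul_mem (P := InQuadLattice ν ρ) ?_ ?_ ?_ q p hp
  · rintro _ _ ⟨s, x, y, rfl⟩ ⟨s', x', y', rfl⟩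
    exact ⟨s + s', x + x', y + y', by push_cast; ring⟩
  · rintro a _ ⟨s, x, y, rfl⟩
    exact ⟨a * s, a * x, a * y, by push_cast; ring⟩
  · rintro _ ⟨s, x, y, rfl⟩
    -- Modulo `Q`, `X (1 + 8X) ≡ -8 (1 + 8X) + 105 X`, and `105 ν = 5e · 3ρ` because `μe = 7`.
    refine ⟨𝕏 * s + 8 * ν * x + 3 * ρ * y, -8 * x - 3 * μ * y, 5 * e * x + 13 * y, ?_⟩
    have he' := congrArg (Int.cast : ℤ → ℤ[X]) he
    rw [hρ]
    push_cast at he' ⊢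
    unfold quadPoly
    linear_combination (- 15 * 𝕏 * (ν : ℤ[X]) * x) * he'

lemma InCubicLattice.mul {ν ρ μ e c n s : ℤ} (hρ : ρ = μ * ν) (he : μ * e = 7)
    (hc : 3 * c + ρ = s * n) (q p : ℤ[X]) (hp : InCubicLattice ν ρ c n p) :
    InCubicLattice ν ρ c n (q * p) := by
  refine mul_mem_of_X_mul_mem (P := InCubicLattice ν ρ c n) ?_ ?_ ?_ q p hp
  · rintro _ _ ⟨s, x, t, z, rfl⟩ ⟨s', x', t', z', rfl⟩
    exact ⟨s + s', x + x', t + t', z + z', by push_cast; ring⟩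
  · rintro a _ ⟨s, x, t, z, rfl⟩
    exact ⟨a * s, a * x, a * t, a * z, by push_cast; ring⟩
  · rintro _ ⟨u, x, t, z, rfl⟩
    -- The first two multipliers come from reduction modulo `Q` in the basis `5X - 2`, `1 - 2X`.
    -- What is left over in the `Q`-direction is a multiple of `3c + ρ = sn`.
    refine ⟨𝕏 * u + ν * x + t * c + n * z, 13 * x - 5 * μ * t, 3 * e * x - 8 * t,
      z - e * s * x + 3 * s * t, ?_⟩
    have he' := congrArg (Int.cast : ℤ → ℤ[X]) he
    have hc' := congrArg (Int.cast : ℤ → ℤ[X]) hc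
    rw [hρ] at hc' ⊢
    push_cast at he' hc' ⊢
    unfold quadPoly
    linear_combination (ν * x * (𝕏 ^ 2 - 5 * 𝕏 + 1) - 3 * ν * x * (1 - 2 * 𝕏)) * he'
      + (3 * t - e * x) * (𝕏 ^ 2 - 5 * 𝕏 + 1) * hc'

lemma mem_of_X_pow_mul_mem {I : Ideal ℤ[X]} {g : ℤ[X]} (hg : 𝕏 * g - 1 ∈ I)
    (k : ℕ) {p : ℤ[X]} (hp : 𝕏 ^ k * p ∈ I) : p ∈ I := by
  induction k with
  | zero => simpa using hp
  | succ k ih =>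
    apply ih
    have h1 := I.mul_mem_left g hp
    have h2 := I.mul_mem_right (𝕏 ^ k * p) hg
    have := I.sub_mem h1 h2
    convert this using 1
    ring

lemma add_mul_X_eq_zero {a b : ℤ} {s : ℤ[X]} (h : (a : ℤ[X]) + b * 𝕏 = quadPoly * s) :
    a = 0 ∧ b = 0 := by
  have hm : quadPoly.Monic := by unfold quadPoly; monicity!
  have hd : quadPoly.natDegree = 2 := by unfold quadPoly; compute_degree!
  have h0 : (a : ℤ[X]) + b * 𝕏 = 0 := by
    by_contra h0
    refine hm.not_dvd_of_natDegree_lt h0 ?_ ⟨s, h⟩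
    rw [hd]
    refine lt_of_le_of_lt (b := 1) ?_ (by norm_num)
    compute_degree
  have h1 := congrArg (eval 0) h0
  have h2 := congrArg (eval 1) h0
  simp at h1 h2
  exact ⟨h1, by omega⟩

lemma add_mul_X_add_mul_quadPoly_eq_zero {a b c : ℤ} {s : ℤ[X]}
    (h : (a : ℤ[X]) + b * 𝕏 + c * quadPoly = (𝕏 - 1) * quadPoly * s) :
    a = 0 ∧ b = 0 ∧ c = 0 := by
  obtain ⟨rfl, rfl⟩ := add_mul_X_eq_zero (a := a) (b := b) (s := (𝕏 - 1) * s - c)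
    (by linear_combination h)
  have h1 := congrArg (eval 1) h
  simp [quadPoly] at h1
  exact ⟨rfl, rfl, h1⟩

/-- The ideal `(X² - 5X + 1, Xⁿ - 1)`. -/
noncomputable def quadIdeal (n : ℕ) : Ideal ℤ[X] := Ideal.span {quadPoly, 𝕏 ^ n - 1}

/-- The ideal `((X - 1)² (X² - 5X + 1), Xⁿ - 1)`. -/
noncomputable def quarticIdeal (n : ℕ) : Ideal ℤ[X] :=
  Ideal.span {(𝕏 - 1) ^ 2 * quadPoly, 𝕏 ^ n - 1}

/-- The ideal `((X - 1) (X² - 5X + 1), 1 + X + ⋯ + X ^ (n - 1))`. -/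
noncomputable def cubicIdeal (n : ℕ) : Ideal ℤ[X] :=
  Ideal.span {(𝕏 - 1) * quadPoly, geomPoly n}

/-- Both generators vanish at 1, forcing `k = 0`; each is `X - 1` times a generator of the cubic
ideal, and `X - 1` cancels. -/
lemma mem_quarticIdeal_iff {n : ℕ} {k : ℤ} {p : ℤ[X]} :
    (k : ℤ[X]) + (𝕏 - 1) * p ∈ quarticIdeal n ↔ k = 0 ∧ p ∈ cubicIdeal n := by
  simp only [quarticIdeal, cubicIdeal, Ideal.mem_span_pair]
  have hg := sub_one_mul_geomPoly n
  constructor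
  · rintro ⟨a, b, h⟩
    have hk : k = 0 := by
      have := congrArg (eval 1) h
      simpa using this.symm
    subst hk
    refine ⟨rfl, a, b, ?_⟩
    have h1 : (𝕏 - 1) ≠ 0 := X_sub_C_ne_zero (1 : ℤ)
    apply mul_left_cancel₀ h1
    push_cast at h
    linear_combination h + b * hg
  · rintro ⟨rfl, a, b, h⟩
    exact ⟨a, b, by push_cast; linear_combination (𝕏 - 1) * h - b * hg⟩

/-- As `X` is a unit modulo `Q`, the ideal is `(Q, g)`. The lattice is closed under multiplication
and contains `g`; conversely `a` and `b` exhibit its generators as multiples of `g`. -/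
lemma mem_quadIdeal_iff {n k : ℕ} {ν ρ μ e : ℤ} {g a b : ℤ[X]} (hρ : ρ = μ * ν)
    (he : μ * e = 7) (hg : quadPoly ∣ 𝕏 ^ n - 1 - 𝕏 ^ k * g) (hlat : InQuadLattice ν ρ g)
    (ha : quadPoly ∣ ν * (1 + 8 * 𝕏) - a * g) (hb : quadPoly ∣ 3 * ρ * 𝕏 - b * g) (p : ℤ[X]) :
    p ∈ quadIdeal n ↔ InQuadLattice ν ρ p := by
  have hinv : 𝕏 * (5 - 𝕏) - 1 ∈ quadIdeal n :=
    Ideal.mem_span_pair.2 ⟨-1, 0, by unfold quadPoly; ring⟩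
  obtain ⟨d, hd⟩ := hg
  have hgI : g ∈ quadIdeal n := mem_of_X_pow_mul_mem hinv k
    (Ideal.mem_span_pair.2 ⟨-d, 1, by linear_combination hd⟩)
  have hQ : quadPoly ∈ quadIdeal n := Ideal.subset_span (by simp)
  constructor
  · intro h
    obtain ⟨u, v, rfl⟩ := Ideal.mem_span_pair.1 h
    obtain ⟨s, x, y, hs⟩ := hlat.mul hρ he (v * 𝕏 ^ k)
    exact ⟨s + u + v * d, x, y, by linear_combination hs + v * hd⟩
  · rintro ⟨s, x, y, rfl⟩
    obtain ⟨a', ha⟩ := ha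
    obtain ⟨b', hb⟩ := hb
    have h := (quadIdeal n).add_mem ((quadIdeal n).mul_mem_left (s + x * a' + y * b') hQ)
      ((quadIdeal n).mul_mem_left (x * a + y * b) hgI)
    convert h using 1
    linear_combination x * ha + y * hb

lemma mem_cubicIdeal_iff {n k : ℕ} {ν ρ μ e c s : ℤ} {g a b : ℤ[X]} (hρ : ρ = μ * ν)
    (he : μ * e = 7) (hc : 3 * c + ρ = s * n)
    (hg : (𝕏 - 1) * quadPoly ∣ geomPoly n - 𝕏 ^ k * g) (hlat : InCubicLattice ν ρ c n g)
    (ha : (𝕏 - 1) * quadPoly ∣ ν * (quadPoly + 5 * 𝕏 - 2) - a * g)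
    (hb : (𝕏 - 1) * quadPoly ∣ ρ * (1 - 2 * 𝕏) + c * quadPoly - b * g) (p : ℤ[X]) :
    p ∈ cubicIdeal n ↔ InCubicLattice ν ρ c n p := by
  have hinv : 𝕏 * (𝕏 ^ 2 - 6 * 𝕏 + 6) - 1 ∈ cubicIdeal n :=
    Ideal.mem_span_pair.2 ⟨1, 0, by unfold quadPoly; ring⟩
  obtain ⟨d, hd⟩ := hg
  have hgI : g ∈ cubicIdeal n := mem_of_X_pow_mul_mem hinv k
    (Ideal.mem_span_pair.2 ⟨-d, 1, by linear_combination hd⟩)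
  have hQ : (𝕏 - 1) * quadPoly ∈ cubicIdeal n := Ideal.subset_span (by simp)
  -- Modulo `(X - 1) Q`, multiplying `Q` by the geometric sum only sees its value `n` at 1.
  have hnQ : (n : ℤ[X]) * quadPoly ∈ cubicIdeal n := by
    obtain ⟨a, ha⟩ := sub_one_dvd_sub_eval (geomPoly n)
    rw [eval_one_geomPoly] at ha
    refine Ideal.mem_span_pair.2 ⟨-a, quadPoly, ?_⟩
    push_cast at ha
    linear_combination quadPoly * ha
  constructor
  · intro h
    obtain ⟨u, v, rfl⟩ := Ideal.mem_span_pair.1 h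
    obtain ⟨s, x, t, z, hs⟩ := hlat.mul hρ he hc (v * 𝕏 ^ k)
    exact ⟨s + u + v * d, x, t, z, by linear_combination hs + v * hd⟩
  · rintro ⟨s, x, t, z, rfl⟩
    obtain ⟨a', ha⟩ := ha
    obtain ⟨b', hb⟩ := hb
    have h := (cubicIdeal n).add_mem ((cubicIdeal n).add_mem
      ((cubicIdeal n).mul_mem_left (s + x * a' + t * b') hQ)
      ((cubicIdeal n).mul_mem_left (x * a + t * b) hgI)) ((cubicIdeal n).mul_mem_left z hnQ)
    convert h using 1
    push_cast
    linear_combination x * ha + t * hb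

/-- Both ideals, described as explicit lattices modulo `X² - 5X + 1` and
`(X - 1) (X² - 5X + 1)`. -/
lemma exists_lattice_data (n : ℕ) (hn : 0 < n) :
    ∃ c : ℤ, 3 * c + muSeq n * nuInt n = oddSign n * n ∧
      (∀ p : ℤ[X], p ∈ quadIdeal n ↔ InQuadLattice (nuInt n) (muSeq n * nuInt n) p) ∧
      (∀ p : ℤ[X], p ∈ cubicIdeal n ↔ InCubicLattice (nuInt n) (muSeq n * nuInt n) c n p) := by
  have hgeom := sub_one_mul_geomPoly n
  rcases Nat.even_or_odd n with he | ho
  · obtain ⟨k, rfl⟩ : ∃ k, n = 2 * k + 2 := by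
      obtain ⟨m, rfl⟩ := he; exact ⟨m - 1, by omega⟩
    have hmu : muSeq (2 * k + 2) = 7 := by simp [muSeq, he]
    have hsg : oddSign (2 * k + 2) = -1 := by simp [oddSign, he]
    have hdvd := quadPoly_dvd_geomPoly_even k
    obtain ⟨c, hc, hb⟩ := exists_geomPoly_congr hdvd
    obtain ⟨q, hq⟩ := hdvd
    generalize nuInt (2 * k + 2) = ν at *
    simp only [eval_mul, eval_add, eval_X, eval_one, eval_intCast, Int.cast_id] at hc
    generalize 2 * k + 2 = n at *
    rw [hmu, hsg]
    -- Here `p = ν (X + 1)` has `p(1) = 2ν`, so `n = 2ν - 3c`; lowering `c` by `3ν` produces the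
    -- coefficient `μ = 7`.
    have hc' : 3 * (c - 3 * ν) + (7 : ℕ) * ν = -1 * n := by push_cast; linarith
    refine ⟨c - 3 * ν, hc', mem_quadIdeal_iff (k := k) (e := 1) (g := ν * (𝕏 ^ 2 - 1))
      (a := 𝕏 - 3) (b := 2 * 𝕏 - 5) rfl (by norm_num) ?_ ?_ ?_ ?_, mem_cubicIdeal_iff
      (a := 𝕏 - 1) (b := 4 - 3 * 𝕏) (e := 1) rfl (by norm_num) hc' hb ?_ ?_ ?_⟩
    · exact ⟨(𝕏 - 1) * q, by linear_combination (𝕏 - 1) * hq - hgeom⟩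
    · exact ⟨ν, -2, 1, by unfold quadPoly; push_cast; ring⟩
    · exact ⟨-ν * (𝕏 + 2), by unfold quadPoly; ring⟩
    · exact ⟨-ν * (2 * 𝕏 + 5), by unfold quadPoly; push_cast; ring⟩
    · exact ⟨0, 3, 1, 0, by unfold quadPoly; push_cast; ring⟩
    · exact ⟨-c, by unfold quadPoly; ring⟩
    · exact ⟨3 * c, by unfold quadPoly; push_cast; ring⟩
  · obtain ⟨k, rfl⟩ := ho
    have ho : ¬ Even (2 * k + 1) := by simp
    have hmu : muSeq (2 * k + 1) = 1 := by simp [muSeq]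
    have hsg : oddSign (2 * k + 1) = 1 := by simp [oddSign]
    have hdvd := quadPoly_dvd_geomPoly_odd k
    obtain ⟨c, hc, hb⟩ := exists_geomPoly_congr hdvd
    obtain ⟨q, hq⟩ := hdvd
    generalize nuInt (2 * k + 1) = ν at *
    simp only [eval_intCast, Int.cast_id] at hc
    generalize 2 * k + 1 = n at *
    rw [hmu, hsg]
    have hc' : 3 * (-c) + (1 : ℕ) * ν = 1 * n := by push_cast; linarith
    have hcX := congrArg (Int.cast : ℤ → ℤ[X]) hc
    push_cast at hcX
    refine ⟨-c, hc', mem_quadIdeal_iff (k := k) (e := 7) (g := ν * (𝕏 - 1))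
      (a := 3 * 𝕏 - 4) (b := 𝕏 - 1) rfl (by norm_num) ?_ ?_ ?_ ?_, mem_cubicIdeal_iff
      (a := quadPoly + 5 * 𝕏 - 2) (b := 1 - 2 * 𝕏) (e := 7) rfl (by norm_num) hc' hb ?_ ?_ ?_⟩
    · exact ⟨(𝕏 - 1) * q, by linear_combination (𝕏 - 1) * hq - hgeom⟩
    · exact ⟨0, -1, 3, by unfold quadPoly; push_cast; ring⟩
    · exact ⟨-3 * ν, by unfold quadPoly; ring⟩
    · exact ⟨-ν, by unfold quadPoly; push_cast; ring⟩
    · refine ⟨0, 2, 5, -2, ?_⟩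
      push_cast
      unfold quadPoly
      linear_combination 2 * (𝕏 ^ 2 - 5 * 𝕏 + 1) * hcX
    · exact ⟨-c * (𝕏 + 1), by unfold quadPoly; ring⟩
    · exact ⟨2 * c, by unfold quadPoly; push_cast; ring⟩

/-! ### Integer coordinates on the quotients -/

lemma inQuadLattice_linear_iff {ν ρ a b : ℤ} :
    InQuadLattice ν ρ ((a : ℤ[X]) + b * 𝕏) ↔ ν ∣ a ∧ 3 * ρ ∣ b - 8 * a := by
  constructor
  · rintro ⟨s, x, y, h⟩
    obtain ⟨h1, h2⟩ := add_mul_X_eq_zero (a := a - ν * x) (b := b - 8 * ν * x - 3 * ρ * y) (s := s)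
      (by push_cast; linear_combination h)
    exact ⟨⟨x, by linarith⟩, ⟨y, by linarith⟩⟩
  · rintro ⟨⟨x, rfl⟩, ⟨y, hy⟩⟩
    obtain rfl : b = 3 * ρ * y + 8 * (ν * x) := by linarith
    exact ⟨0, x, y, by push_cast; ring⟩

/-- The pair `5X - 2`, `1 - 2X` is a unimodular basis of the linear polynomials; `b + 2a` and `5a +
2b` are the coordinates of `a + bX` in it. -/
lemma inCubicLattice_quadratic_iff {ν ρ c n a b d : ℤ} :
    InCubicLattice ν ρ c n ((a : ℤ[X]) + b * 𝕏 + d * quadPoly) ↔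
      ν ∣ b + 2 * a ∧ ∃ t, 5 * a + 2 * b = ρ * t ∧ n ∣ d - (b + 2 * a) - c * t := by
  constructor
  · rintro ⟨s, x, t, z, h⟩
    obtain ⟨h1, h2, h3⟩ := add_mul_X_add_mul_quadPoly_eq_zero (a := a + 2 * ν * x - ρ * t)
      (b := b - 5 * ν * x + 2 * ρ * t) (c := d - ν * x - c * t - n * z) (s := s)
      (by push_cast; linear_combination h)
    exact ⟨⟨x, by linarith⟩, t, by linarith, ⟨z, by linarith⟩⟩
  · rintro ⟨⟨x, hx⟩, t, ht, ⟨z, hz⟩⟩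
    obtain rfl : b = ν * x - 2 * a := by linarith
    obtain rfl : a = ρ * t - 2 * ν * x := by linarith
    obtain rfl : d = n * z + ν * x + c * t := by linarith
    exact ⟨0, x, t, z, by push_cast; ring⟩

lemma exists_linear_add_mul_quadPoly (p : ℤ[X]) :
    ∃ (a b : ℤ) (s : ℤ[X]), p = (a : ℤ[X]) + b * 𝕏 + quadPoly * s := by
  have hm : quadPoly.Monic := by unfold quadPoly; monicity!
  have hd : quadPoly.natDegree = 2 := by unfold quadPoly; compute_degree!
  have h := modByMonic_add_div p quadPoly
  have hlt : (p %ₘ quadPoly).natDegree < 2 := by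
    rw [← hd]
    exact natDegree_modByMonic_lt _ hm (by intro h1; simp [h1] at hd)
  obtain ⟨a, b, hab⟩ := exists_eq_X_add_C_of_natDegree_le_one (p := p %ₘ quadPoly) (by omega)
  refine ⟨b, a, p /ₘ quadPoly, ?_⟩
  rw [hab] at h
  simp only [eq_intCast] at h
  linear_combination -h

lemma exists_cubic_add_mul (p : ℤ[X]) :
    ∃ (k a b d : ℤ) (s : ℤ[X]), p = (k : ℤ[X]) + (𝕏 - 1) * ((a : ℤ[X]) + b * 𝕏 + d * quadPoly)
      + (𝕏 - 1) ^ 2 * quadPoly * s := by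
  obtain ⟨q, hq⟩ := sub_one_dvd_sub_eval p
  obtain ⟨a, b, r, hr⟩ := exists_linear_add_mul_quadPoly q
  obtain ⟨s, hs⟩ := sub_one_dvd_sub_eval r
  exact ⟨p.eval 1, a, b, r.eval 1, s, by
    linear_combination hq + (𝕏 - 1) * hr + (𝕏 - 1) * quadPoly * hs⟩

/-! ### The graph, its Laplacian and the shift -/

section Torus

variable {n : ℕ}

lemma deltaStep_one (x : Fin 3) : deltaStep 1 1 1 x = 1 := by fin_cases x <;> rfl

lemma deltaGraph_one_adj {u v : Fin 3 × ZMod n} (hn : 3 ≤ n) : (deltaGraph n 1 1 1).Adj u v ↔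
    (u.1 = v.1 ∧ (v.2 = u.2 + 1 ∨ u.2 = v.2 + 1)) ∨ (u.1 ≠ v.1 ∧ u.2 = v.2) := by
  have h1 : (1 : ZMod n) ≠ 0 := by
    rw [← Nat.cast_one, Ne, ZMod.natCast_eq_zero_iff]
    exact fun h => by have := Nat.le_of_dvd one_pos h; omega
  simp only [deltaGraph, deltaStep_one, Int.cast_one]
  constructor
  · exact fun h => h.2
  · refine fun h => ⟨?_, h⟩
    rintro rfl
    simp [h1] at h

variable [NeZero n]

lemma deltaGraph_one_iso (hn : 3 ≤ n) : Nonempty (deltaGraph n 1 1 1 ≃g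
    SimpleGraph.boxProd (SimpleGraph.cycleGraph 3) (SimpleGraph.cycleGraph n)) := by
  obtain ⟨m, rfl⟩ : ∃ m, n = m + 2 := ⟨n - 2, by omega⟩
  refine ⟨⟨Equiv.refl (Fin 3 × ZMod (m + 2)), ?_⟩⟩
  rintro ⟨x, y⟩ ⟨x', y'⟩
  change (SimpleGraph.boxProd (SimpleGraph.cycleGraph 3) (SimpleGraph.cycleGraph (m + 2))).Adj
    ((x, y) : Fin 3 × Fin (m + 2)) (x', y') ↔ _
  rw [deltaGraph_one_adj hn, SimpleGraph.boxProd_adj]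
  have h1 : (SimpleGraph.cycleGraph 3).Adj x x' ↔ x ≠ x' := by
    revert x x'; decide
  have h2 (a b : Fin (m + 2)) : (SimpleGraph.cycleGraph (m + 2)).Adj a b ↔
      (b = a + 1 ∨ a = b + 1) := by
    rw [SimpleGraph.cycleGraph_adj, or_comm]
    exact or_congr sub_eq_iff_eq_add' sub_eq_iff_eq_add'
  have h3 : (SimpleGraph.cycleGraph (m + 2)).Adj y y' ↔ (y' = y + 1 ∨ y = y' + 1) := h2 y y'
  simp only [h1]
  tauto

lemma sum_neighborFinset_deltaGraph {A : Type*} [AddCommGroup A] (hn : 3 ≤ n)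
    (f : Fin 3 × ZMod n → A) (x : Fin 3) (y : ZMod n) :
    ∑ u ∈ (deltaGraph n 1 1 1).neighborFinset (x, y), f u
      = f (x, y + 1) + f (x, y - 1) + ((∑ x', f (x', y)) - f (x, y)) := by
  have h2 : y + 1 ≠ y - 1 := by
    intro h
    have h' : ((2 : ℕ) : ZMod n) = 0 := by push_cast; linear_combination h
    rw [ZMod.natCast_eq_zero_iff] at h'
    have := Nat.le_of_dvd two_pos h'
    omega
  have hN : (deltaGraph n 1 1 1).neighborFinset (x, y)
      = insert (x, y + 1) (insert (x, y - 1) ((Finset.univ.erase x) ×ˢ {y})) := by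
    ext ⟨a, b⟩
    rw [SimpleGraph.mem_neighborFinset, deltaGraph_one_adj hn]
    simp only [Finset.mem_insert, Finset.mem_product, Finset.mem_erase, Finset.mem_univ,
      Finset.mem_singleton, Prod.mk.injEq]
    rw [eq_sub_iff_add_eq, eq_comm (a := b + 1), eq_comm (a := a) (b := x),
      eq_comm (a := b) (b := y), ne_comm]
    tauto
  have hnot (y' : ZMod n) : (x, y') ∉ (Finset.univ.erase x) ×ˢ {y} := fun h =>
    (Finset.mem_erase.1 (Finset.mem_product.1 h).1).1 rfl
  rw [hN, Finset.sum_insert (by simp [h2]), Finset.sum_insert (hnot _), Finset.sum_product,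
    ← Finset.sum_erase_eq_sub (Finset.mem_univ x)]
  simp [add_assoc]

lemma lapMatrix_deltaGraph_mulVec (hn : 3 ≤ n) (z : Fin 3 × ZMod n → ℤ) (x : Fin 3) (y : ZMod n) :
    ((deltaGraph n 1 1 1).lapMatrix ℤ).mulVec z (x, y)
      = 5 * z (x, y) - z (x, y + 1) - z (x, y - 1) - ∑ x', z (x', y) := by
  have hd : ((deltaGraph n 1 1 1).degree (x, y) : ℤ) = 4 := by
    have := sum_neighborFinset_deltaGraph hn (fun _ => (1 : ℤ)) x y
    rw [← SimpleGraph.card_neighborFinset_eq_degree, Finset.card_eq_sum_ones]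
    push_cast
    rw [this]
    simp
  rw [SimpleGraph.lapMatrix_mulVec_apply, sum_neighborFinset_deltaGraph hn, hd]
  ring

lemma lapMatrix_deltaGraph_single (hn : 3 ≤ n) (x : Fin 3) (y : ZMod n) :
    ((deltaGraph n 1 1 1).lapMatrix ℤ).mulVec (Pi.single (x, y) 1)
      = (5 : ℤ) • Pi.single (x, y) 1 - Pi.single (x, y + 1) 1 - Pi.single (x, y - 1) 1
        - ∑ x', Pi.single (x', y) 1 := by
  ext ⟨a, b⟩
  rw [lapMatrix_deltaGraph_mulVec hn]
  simp only [Pi.sub_apply, Pi.smul_apply, Finset.sum_apply, Pi.single_apply, Prod.mk.injEq,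
    smul_eq_mul]
  have e1 : b + 1 = y ↔ b = y - 1 := eq_sub_iff_add_eq.symm
  have e2 : b - 1 = y ↔ b = y + 1 := sub_eq_iff_eq_add
  simp only [e1, e2]
  have e3 : ∑ x', (if x' = x ∧ b = y then (1 : ℤ) else 0) = if b = y then 1 else 0 := by
    by_cases h : b = y <;> simp [h]
  have e4 : ∑ x', (if a = x' ∧ b = y then (1 : ℤ) else 0) = if b = y then 1 else 0 := by
    by_cases h : b = y <;> simp [h]
  rw [e3, e4]
  ring

/-- The class of the vertex `v_{x,y}` in the cokernel of the Laplacian. -/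
def vertexClass (x : Fin 3) (y : ZMod n) : laplacianCoker (deltaGraph n 1 1 1) :=
  Submodule.Quotient.mk (Pi.single (x, y) 1)

lemma vertexClass_relation (hn : 3 ≤ n) (x : Fin 3) (y : ZMod n) :
    (5 : ℤ) • vertexClass x y - vertexClass x (y + 1) - vertexClass x (y - 1)
      - (vertexClass 0 y + vertexClass 1 y + vertexClass 2 y) = 0 := by
  have h : Submodule.Quotient.mk (p := LinearMap.range
      (Matrix.mulVecLin ((deltaGraph n 1 1 1).lapMatrix ℤ)))
      (((deltaGraph n 1 1 1).lapMatrix ℤ).mulVec (Pi.single (x, y) 1)) = 0 :=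
    (Submodule.Quotient.mk_eq_zero _).2 ⟨_, rfl⟩
  rw [lapMatrix_deltaGraph_single hn, Fin.sum_univ_three] at h
  exact h

/-- A function on the vertices that is annihilated by the Laplacian induces a homomorphism on the
cokernel. -/
lemma exists_hom_of_harmonic {B : Type*} [AddCommGroup B] (hn : 3 ≤ n) (b : Fin 3 → ZMod n → B)
    (hb : ∀ x y, (5 : ℤ) • b x y - b x (y + 1) - b x (y - 1) - (b 0 y + b 1 y + b 2 y) = 0) :
    ∃ φ : laplacianCoker (deltaGraph n 1 1 1) →ₗ[ℤ] B, ∀ x y, φ (vertexClass x y) = b x y := by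
  set l := Fintype.linearCombination ℤ (fun v : Fin 3 × ZMod n => b v.1 v.2) with hl
  have hs (x : Fin 3) (y : ZMod n) : l (Pi.single (x, y) 1) = b x y := by
    simp [hl]
  refine ⟨Submodule.liftQ _ l ?_, fun x y => hs x y⟩
  rw [LinearMap.range_le_ker_iff]
  refine (Pi.basisFun ℤ _).ext ?_
  rintro ⟨x, y⟩
  rw [Pi.basisFun_apply, LinearMap.comp_apply, Matrix.mulVecLin_apply,
    lapMatrix_deltaGraph_single hn]
  simp only [map_sub, map_smul, map_add, hs, Fin.sum_univ_three]
  simpa using hb x y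

lemma vertexClass_induction {P : laplacianCoker (deltaGraph n 1 1 1) → Prop}
    (hv : ∀ x y, P (vertexClass x y)) (h0 : P 0) (hadd : ∀ a b, P a → P b → P (a + b))
    (hsmul : ∀ (k : ℤ) a, P a → P (k • a)) (m) : P m := by
  obtain ⟨z, rfl⟩ := Submodule.Quotient.mk_surjective _ m
  have hz : z = ∑ v, z v • Pi.single v (1 : ℤ) := by
    ext v; simp [Finset.sum_apply, Pi.single_apply]
  rw [hz, ← Submodule.mkQ_apply, map_sum]
  refine Finset.sum_induction _ P hadd h0 fun v _ => ?_
  rw [map_smul]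
  exact hsmul _ _ (hv v.1 v.2)

lemma exists_shift (hn : 3 ≤ n) : ∃ σ : Module.End ℤ (laplacianCoker (deltaGraph n 1 1 1)),
    ∀ x y, σ (vertexClass x y) = vertexClass x (y + 1) := by
  refine exists_hom_of_harmonic hn _ fun x y => ?_
  rw [← vertexClass_relation hn x (y + 1)]
  simp

end Torus

/-! ### The cokernel as a `ℤ[X]`-module on two generators -/

section Presentation

variable {n : ℕ} [NeZero n]

lemma aeval_X_pow_vertexClass {σ : Module.End ℤ (laplacianCoker (deltaGraph n 1 1 1))}
    (hσ : ∀ x y, σ (vertexClass x y) = vertexClass x (y + 1)) (k : ℕ) (x : Fin 3) (y : ZMod n) :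
    (σ ^ k) (vertexClass x y) = vertexClass x (y + (k : ZMod n)) := by
  induction k with
  | zero => simp
  | succ k ih => rw [pow_succ', Module.End.mul_apply, ih, hσ]; push_cast; rw [add_assoc]

lemma quadPoly_vertexClass (hn : 3 ≤ n) {σ : Module.End ℤ (laplacianCoker (deltaGraph n 1 1 1))}
    (hσ : ∀ x y, σ (vertexClass x y) = vertexClass x (y + 1)) (x : Fin 3) (y : ZMod n) :
    aeval σ quadPoly (vertexClass x y)
      = - (vertexClass 0 (y + 1) + vertexClass 1 (y + 1) + vertexClass 2 (y + 1)) := by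
  have h := vertexClass_relation hn x (y + 1)
  have e : aeval σ quadPoly = σ ^ 2 - (5 : ℤ) • σ + 1 := by
    simp [quadPoly, zsmul_eq_mul, map_ofNat]
  rw [e]
  simp only [LinearMap.add_apply, LinearMap.sub_apply, LinearMap.smul_apply, Module.End.one_apply,
    aeval_X_pow_vertexClass hσ, hσ]
  rw [add_sub_cancel_right, add_assoc y 1 1, one_add_one_eq_two] at h
  push_cast
  rw [← sub_eq_zero, ← neg_eq_zero, ← h]
  abel

/-- A pair of polynomials in the shift, applied to a pair of generators of the cokernel. -/
noncomputable def presentation (σ : Module.End ℤ (laplacianCoker (deltaGraph n 1 1 1))) :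
    ℤ[X] × ℤ[X] →+ laplacianCoker (deltaGraph n 1 1 1) where
  toFun p := aeval σ p.1 (vertexClass 0 0 - vertexClass 2 0) + aeval σ p.2 (vertexClass 2 0)
  map_zero' := by simp
  map_add' p q := by simp only [Prod.fst_add, Prod.snd_add, map_add, LinearMap.add_apply]; abel

lemma presentation_apply (σ : Module.End ℤ (laplacianCoker (deltaGraph n 1 1 1)))
    (p q : ℤ[X]) : presentation σ (p, q) = 
      aeval σ p (vertexClass 0 0 - vertexClass 2 0) + aeval σ q (vertexClass 2 0) := rfl

lemma presentation_X_pow_mul (σ : Module.End ℤ (laplacianCoker (deltaGraph n 1 1 1)))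
    (k : ℕ) (p q : ℤ[X]) :
    presentation σ (𝕏 ^ k * p, 𝕏 ^ k * q) = (σ ^ k) (presentation σ (p, q)) := by
  simp [presentation_apply]

lemma presentation_surjective (hn : 3 ≤ n)
    {σ : Module.End ℤ (laplacianCoker (deltaGraph n 1 1 1))}
    (hσ : ∀ x y, σ (vertexClass x y) = vertexClass x (y + 1)) :
    Function.Surjective (presentation σ) := by
  have key (x : Fin 3) : ∃ (y : ZMod n) (p : ℤ[X] × ℤ[X]), presentation σ p = vertexClass x y := by
    fin_cases x
    · exact ⟨0, (1, 1), by simp [presentation_apply]⟩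
    · refine ⟨1, (-𝕏, -quadPoly - 2 * 𝕏), ?_⟩
      have h := quadPoly_vertexClass hn hσ 2 0
      have e : aeval σ (-quadPoly - 2 * 𝕏) = - aeval σ quadPoly - (2 : ℤ) • σ := by
        simp [zsmul_eq_mul, map_ofNat]
      rw [presentation_apply, e]
      simp only [map_neg, aeval_X, LinearMap.neg_apply, LinearMap.sub_apply, LinearMap.smul_apply,
        map_sub, hσ, h, zero_add]
      simp only [Fin.mk_one]
      module
    · exact ⟨0, (0, 1), by simp [presentation_apply]⟩
  intro m
  change m ∈ (presentation σ).range
  induction m using vertexClass_induction with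
  | hv x y =>
    obtain ⟨y', p, hp⟩ := key x
    refine ⟨(𝕏 ^ (y - y').val * p.1, 𝕏 ^ (y - y').val * p.2), ?_⟩
    rw [presentation_X_pow_mul, hp, aeval_X_pow_vertexClass hσ]
    simp
  | h0 => exact zero_mem _
  | hadd a b ha hb => exact add_mem ha hb
  | hsmul k a ha => exact zsmul_mem ha k

lemma presentation_eq_zero (hn : 3 ≤ n)
    {σ : Module.End ℤ (laplacianCoker (deltaGraph n 1 1 1))}
    (hσ : ∀ x y, σ (vertexClass x y) = vertexClass x (y + 1)) {p q : ℤ[X]}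
    (hp : p ∈ quadIdeal n) (hq : q ∈ quarticIdeal n) : presentation σ (p, q) = 0 := by
  have hpow : aeval σ (𝕏 ^ n - 1) = 0 := by
    rw [map_sub, map_pow, aeval_X, map_one, sub_eq_zero]
    refine LinearMap.ext fun m => ?_
    induction m using vertexClass_induction with
    | hv x y => rw [aeval_X_pow_vertexClass hσ]; simp
    | h0 => simp
    | hadd a b ha hb => rw [map_add, map_add, ha, hb]
    | hsmul k a ha => rw [map_smul, map_smul, ha]
  obtain ⟨a, b, rfl⟩ := Ideal.mem_span_pair.1 hp
  obtain ⟨c, d, rfl⟩ := Ideal.mem_span_pair.1 hq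
  have hQ := quadPoly_vertexClass hn hσ
  have h2 : aeval σ ((𝕏 - 1) ^ 2 * quadPoly) (vertexClass 2 0) = 0 := by
    -- `Q v_2 = -X (v_0 + v_1 + v_2)`, and summing the three relations shows that `Q + 3X = (X -
    -- 1)²` kills this sum.
    rw [show (𝕏 - 1) ^ 2 = quadPoly + 3 * 𝕏 by unfold quadPoly; ring, map_mul,
      Module.End.mul_apply, hQ]
    have e : aeval σ (quadPoly + 3 * 𝕏) = aeval σ quadPoly + (3 : ℤ) • σ := by
      simp [zsmul_eq_mul, map_ofNat]
    rw [e]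
    simp only [LinearMap.add_apply, LinearMap.smul_apply, map_neg, map_add, hσ, hQ]
    module
  have h1 : aeval σ quadPoly (vertexClass 0 0 - vertexClass 2 0) = 0 := by
    rw [map_sub, hQ, hQ, sub_self]
  rw [presentation_apply, map_add, map_add, map_mul _ b, map_mul _ d, hpow, map_mul _ a,
    map_mul _ c]
  simp only [Module.End.mul_apply, h1, h2, mul_zero, map_zero, add_zero]

omit [NeZero n] in
lemma pow_val_add_one {B : Type*} [Monoid B] [NeZero n] {τ : B} (hτ : τ ^ n = 1) (y : ZMod n) :
    τ ^ (y + 1).val = τ * τ ^ y.val := by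
  rw [ZMod.val_add, ← pow_eq_pow_mod _ hτ, pow_add, ZMod.val_one_eq_one_mod,
    ← pow_eq_pow_mod _ hτ, pow_one, (Commute.pow_self τ _).eq]

/-- Separation of variables: `τ^y ε_x` is harmonic exactly under the stated condition on `ε`, and
`τ^n = 1` makes it periodic in `y`. -/
lemma exists_hom_of_root (hn : 3 ≤ n) {B : Type*} [CommRing B] {τ : B} (hτ : τ ^ n = 1)
    (ε : Fin 3 → B) (hε : ∀ x, (τ ^ 2 - 5 * τ + 1) * ε x = - τ * (ε 0 + ε 1 + ε 2)) :
    ∃ φ : laplacianCoker (deltaGraph n 1 1 1) →ₗ[ℤ] B,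
      ∀ x y, φ (vertexClass x y) = τ ^ y.val * ε x := by
  refine exists_hom_of_harmonic hn _ fun x y => ?_
  obtain ⟨y, rfl⟩ : ∃ y', y = y' + 1 := ⟨y - 1, by simp⟩
  simp only [add_sub_cancel_right, pow_val_add_one hτ, zsmul_eq_mul]
  push_cast
  linear_combination (-τ ^ y.val) * hε x

lemma exists_hom_aeval (hn : 3 ≤ n)
    {σ : Module.End ℤ (laplacianCoker (deltaGraph n 1 1 1))}
    (hσ : ∀ x y, σ (vertexClass x y) = vertexClass x (y + 1)) {B : Type*} [CommRing B]
    (ι : ℤ[X] →+* B) (hι : ι 𝕏 ^ n = 1) (ε : Fin 3 → B)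
    (hε : ∀ x, ι quadPoly * ε x = - ι 𝕏 * (ε 0 + ε 1 + ε 2)) :
    ∃ φ : laplacianCoker (deltaGraph n 1 1 1) →ₗ[ℤ] B,
      ∀ x r, φ (aeval σ r (vertexClass x 0)) = ι r * ε x := by
  obtain ⟨φ, hφ⟩ := exists_hom_of_root hn hι ε (by simpa [quadPoly, map_ofNat] using hε)
  have hφσ (m) : φ (σ m) = ι 𝕏 * φ m := by
    induction m using vertexClass_induction with
    | hv x y => rw [hσ, hφ, hφ, pow_val_add_one hι, mul_assoc]
    | h0 => simp
    | hadd a b ha hb => simp only [map_add, ha, hb, mul_add]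
    | hsmul k a ha => simp only [map_smul, ha, mul_smul_comm]
  have hφp (r : ℤ[X]) (m) : φ (aeval σ r m) = ι r * φ m := by
    induction r using Polynomial.induction_on generalizing m with
    | C a => simp
    | add r s hr hs => simp only [map_add, LinearMap.add_apply, hr, hs, add_mul]
    | monomial k a ih =>
      rw [pow_succ, ← mul_assoc, map_mul (aeval σ), Module.End.mul_apply, ih, aeval_X, hφσ,
        map_mul ι _ 𝕏, mul_assoc]
  exact ⟨φ, fun x r => by rw [hφp, hφ]; simp⟩

/-- Two homomorphisms separate the generators: one sends `(v_0 - v_2, v_2)` to `(1, 0)` modulo the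
quadratic ideal, the other to `(0, 1)` modulo the quartic one. -/
lemma mem_ideals_of_presentation_eq_zero (hn : 3 ≤ n)
    {σ : Module.End ℤ (laplacianCoker (deltaGraph n 1 1 1))}
    (hσ : ∀ x y, σ (vertexClass x y) = vertexClass x (y + 1)) {p q : ℤ[X]}
    (h : presentation σ (p, q) = 0) : p ∈ quadIdeal n ∧ q ∈ quarticIdeal n := by
  have hX {I : Ideal ℤ[X]} (hI : 𝕏 ^ n - 1 ∈ I) : Ideal.Quotient.mk I 𝕏 ^ n = 1 := by
    rw [← map_pow, ← map_one (Ideal.Quotient.mk I)]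
    exact Ideal.Quotient.eq.2 hI
  constructor
  · have hQ : Ideal.Quotient.mk (quadIdeal n) quadPoly = 0 :=
      Ideal.Quotient.eq_zero_iff_mem.2 (Ideal.subset_span (by simp))
    obtain ⟨φ, hφ⟩ := exists_hom_aeval hn hσ (Ideal.Quotient.mk (quadIdeal n))
      (hX (Ideal.subset_span (by simp))) ![1, -1, 0] (fun x => by simp [hQ])
    have := congrArg φ h
    rw [presentation_apply, map_add, map_sub, map_sub, hφ, hφ, hφ, map_zero] at this
    simpa [Ideal.Quotient.eq_zero_iff_mem] using this
  · have hQ : Ideal.Quotient.mk (quarticIdeal n) ((𝕏 - 1) ^ 2 * quadPoly) = 0 :=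
      Ideal.Quotient.eq_zero_iff_mem.2 (Ideal.subset_span (by simp))
    have hτ := hX (I := quarticIdeal n) (Ideal.subset_span (by simp))
    obtain ⟨m, rfl⟩ : ∃ m, n = m + 1 := ⟨n - 1, by omega⟩
    have hroot : Ideal.Quotient.mk (quarticIdeal (m + 1)) quadPoly
        = Ideal.Quotient.mk _ 𝕏 ^ 2 - 5 * Ideal.Quotient.mk _ 𝕏 + 1 := by
      simp [quadPoly, map_ofNat]
    obtain ⟨φ, hφ⟩ := exists_hom_aeval hn hσ (Ideal.Quotient.mk (quarticIdeal (m + 1))) hτ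
      -- With `ε_0 = ε_2 = 1` the relation forces `ε_1 = 3 - τ - τ⁻¹`, and `τ^m = τ⁻¹`.
      ![1, 3 - Ideal.Quotient.mk _ 𝕏 - Ideal.Quotient.mk _ 𝕏 ^ m, 1] (by
        simp only [map_mul, map_pow, map_sub, map_one, hroot] at hQ ⊢
        generalize Ideal.Quotient.mk (quarticIdeal (m + 1)) 𝕏 = τ at hQ hτ
        intro x
        fin_cases x
        · simp
          linear_combination -hτ
        · simp
          linear_combination (-τ ^ m) * hQ + (τ ^ 3 - 7 * τ ^ 2 + 11 * τ - 3) * hτ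
        · simp
          linear_combination -hτ)
    have := congrArg φ h
    rw [presentation_apply, map_add, map_sub, map_sub, hφ, hφ, hφ, map_zero] at this
    simpa [Ideal.Quotient.eq_zero_iff_mem] using this

end Presentation

/-! ### Smith normal form and the structure of the cokernel -/

section Groups

/-- Two quotients of the same group by the same kernel are isomorphic. -/
lemma nonempty_addEquiv_of_ker_eq {G A B : Type*} [AddCommGroup G] [AddCommGroup A]
    [AddCommGroup B] (f : G →+ A) (g : G →+ B) (hf : Function.Surjective f)
    (hg : Function.Surjective g) (h : ∀ x, f x = 0 ↔ g x = 0) : Nonempty (A ≃+ B) := by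
  have hk : f.ker = g.ker := by ext x; exact h x
  exact ⟨(QuotientAddGroup.quotientKerEquivOfSurjective f hf).symm.trans
    ((QuotientAddGroup.quotientAddEquivOfEq hk).trans
      (QuotientAddGroup.quotientKerEquivOfSurjective g hg))⟩

/-- The torsion subgroup of a group isomorphic to the product of `ℤ` and a finite group. -/
lemma nonempty_torsion_addEquiv {M A : Type*} [AddCommGroup M] [AddCommGroup A] [Finite A]
    (e : M ≃+ ℤ × A) : Nonempty (AddCommGroup.torsion M ≃+ A) := by
  let f : AddCommGroup.torsion M →+ A :=
    (AddMonoidHom.snd ℤ A).comp (e.toAddMonoidHom.comp (AddCommGroup.torsion M).subtype)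
  have hf (x) : f x = (e x).2 := rfl
  refine ⟨AddEquiv.ofBijective f ⟨?_, ?_⟩⟩
  · rw [injective_iff_map_eq_zero]
    rintro ⟨x, hx⟩ h
    rw [hf] at h
    have hx' : IsOfFinAddOrder (e x) := e.toAddMonoidHom.isOfFinAddOrder hx
    have h1 : IsOfFinAddOrder (e x).1 := (AddMonoidHom.fst ℤ A).isOfFinAddOrder hx'
    have h1' : (e x).1 = 0 := by
      by_contra h0
      exact not_isOfFinAddOrder_of_isAddTorsionFree h0 h1
    have : e x = 0 := Prod.ext h1' h
    simpa using this
  · intro a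
    have ha : IsOfFinAddOrder ((0, a) : ℤ × A) :=
      (AddMonoidHom.inr ℤ A).isOfFinAddOrder (isOfFinAddOrder_of_finite a)
    refine ⟨⟨e.symm (0, a), e.symm.toAddMonoidHom.isOfFinAddOrder ha⟩, ?_⟩
    rw [hf]
    simp

/-- Smith normal form of the lattice spanned by `(ρ, c)` and `(0, n)`, where `d = gcd(ρ, c)`
divides `n`. -/
lemma smith_two {ρ c n d r c' u v y z : ℤ} (hρ : ρ = d * r) (hc : c = d * c') (hd : d ∣ n)
    (huv : u * r + v * c' = 1) :
    (∃ t, y = ρ * t ∧ n ∣ z - c * t) ↔ d ∣ u * y + v * z ∧ r * n ∣ r * z - c' * y := by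
  obtain ⟨m, rfl⟩ := hd
  subst hρ hc
  -- The map `(y, z) ↦ (uy + vz, rz - c'y)` has determinant `ur + vc' = 1`.
  constructor
  · rintro ⟨t, rfl, w, hw⟩
    obtain rfl : z = d * m * w + d * c' * t := by linarith
    exact ⟨⟨t + v * m * w, by linear_combination d * t * huv⟩, ⟨w, by ring⟩⟩
  · rintro ⟨⟨p, hp⟩, ⟨w, hw⟩⟩
    refine ⟨p - v * m * w, ?_, w, ?_⟩
    · linear_combination r * hp - v * hw - y * huv
    · linear_combination c' * hp + u * hw + (d * m * w - z) * huv

variable {n : ℕ} [NeZero n]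

lemma nonempty_laplacianCoker_addEquiv (hn : 3 ≤ n) {ν ρ d r : ℕ} {c c' u v : ℤ}
    (hquad : ∀ p : ℤ[X], p ∈ quadIdeal n ↔ InQuadLattice ν ρ p)
    (hcub : ∀ p : ℤ[X], p ∈ cubicIdeal n ↔ InCubicLattice ν ρ c n p)
    (hρ : ρ = d * r) (hc : c = d * c') (hd : d ∣ n) (huv : u * r + v * c' = 1) :
    Nonempty (laplacianCoker (deltaGraph n 1 1 1) ≃+
      ℤ × (ZMod ν × ZMod (3 * ρ) × ZMod ν × ZMod d × ZMod (r * n))) := by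
  obtain ⟨σ, hσ⟩ := exists_shift hn
  let f : (ℤ × ℤ) × (ℤ × ℤ × ℤ × ℤ) →+ laplacianCoker (deltaGraph n 1 1 1) :=
    (presentation σ).comp (AddMonoidHom.mk' (fun w => ((w.1.1 : ℤ[X]) + w.1.2 * 𝕏,
      (w.2.1 : ℤ[X]) + (𝕏 - 1) * ((w.2.2.1 : ℤ[X]) + w.2.2.2.1 * 𝕏 + w.2.2.2.2 * quadPoly)))
      (by
        intro w w'
        simp only [Prod.fst_add, Prod.snd_add, Prod.mk_add_mk, Prod.mk.injEq]
        push_cast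
        constructor <;> ring))
  let g : (ℤ × ℤ) × (ℤ × ℤ × ℤ × ℤ) →+
      ℤ × (ZMod ν × ZMod (3 * ρ) × ZMod ν × ZMod d × ZMod (r * n)) :=
    AddMonoidHom.mk' (fun w => (w.2.1, ((w.1.1 : ℤ) : ZMod ν),
        ((w.1.2 - 8 * w.1.1 : ℤ) : ZMod (3 * ρ)),
        ((w.2.2.2.1 + 2 * w.2.2.1 : ℤ) : ZMod ν),
        ((u * (5 * w.2.2.1 + 2 * w.2.2.2.1)
          + v * (w.2.2.2.2 - (w.2.2.2.1 + 2 * w.2.2.1)) : ℤ) : ZMod d),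
        ((r * (w.2.2.2.2 - (w.2.2.2.1 + 2 * w.2.2.1))
          - c' * (5 * w.2.2.1 + 2 * w.2.2.2.1) : ℤ) : ZMod (r * n))))
      (by
        intro w w'
        simp only [Prod.fst_add, Prod.snd_add, Prod.mk_add_mk, Prod.mk.injEq]
        push_cast
        refine ⟨trivial, ?_, ?_, ?_, ?_, ?_⟩ <;> ring)
  refine nonempty_addEquiv_of_ker_eq f g ?_ ?_ ?_
  · intro m
    obtain ⟨⟨p, q⟩, rfl⟩ := presentation_surjective hn hσ m
    obtain ⟨a, b, s, rfl⟩ := exists_linear_add_mul_quadPoly p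
    obtain ⟨k, α, β, γ, s', rfl⟩ := exists_cubic_add_mul q
    refine ⟨((a, b), (k, α, β, γ)), ?_⟩
    have h0 : presentation σ (quadPoly * s, (𝕏 - 1) ^ 2 * quadPoly * s') = 0 :=
      presentation_eq_zero hn hσ (Ideal.mul_mem_right _ _ (Ideal.subset_span (by simp)))
        (Ideal.mul_mem_right _ _ (Ideal.subset_span (by simp)))
    rw [← Prod.mk_add_mk, map_add, h0, add_zero]
    rfl
  · rintro ⟨k, a, b, x, p, q⟩
    obtain ⟨a, rfl⟩ := ZMod.intCast_surjective a
    obtain ⟨b, rfl⟩ := ZMod.intCast_surjective b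
    obtain ⟨x, rfl⟩ := ZMod.intCast_surjective x
    obtain ⟨p, rfl⟩ := ZMod.intCast_surjective p
    obtain ⟨q, rfl⟩ := ZMod.intCast_surjective q
    -- Preimage obtained by inverting the unimodular changes of coordinates.
    refine ⟨((a, b + 8 * a), (k, (r * p - v * q) - 2 * x, 5 * x - 2 * (r * p - v * q),
      c' * p + u * q + x)), ?_⟩
    simp only [g, AddMonoidHom.mk'_apply, Prod.mk.injEq]
    refine ⟨trivial, trivial, ?_, ?_, ?_, ?_⟩ <;> congr 1
    · ring
    · ring
    · linear_combination p * huv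
    · linear_combination q * huv
  · rintro ⟨⟨a, b⟩, ⟨k, α, β, γ⟩⟩
    have hf : f ((a, b), (k, α, β, γ)) = 0 ↔ (a : ℤ[X]) + b * 𝕏 ∈ quadIdeal n ∧
        (k : ℤ[X]) + (𝕏 - 1) * ((α : ℤ[X]) + β * 𝕏 + γ * quadPoly) ∈ quarticIdeal n :=
      ⟨mem_ideals_of_presentation_eq_zero hn hσ, fun h => presentation_eq_zero hn hσ h.1 h.2⟩
    rw [hf, mem_quarticIdeal_iff, hquad, hcub, inQuadLattice_linear_iff,
      inCubicLattice_quadratic_iff, smith_two (r := (r : ℤ)) (by rw [hρ]; push_cast; rfl) hc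
        (by exact_mod_cast hd) huv]
    simp only [g, AddMonoidHom.mk'_apply, Prod.mk_eq_zero, ZMod.intCast_zmod_eq_zero_iff_dvd]
    push_cast
    tauto

end Groups

/-! ### Greatest common divisors -/

section Arithmetic

lemma oddSign_mul_self (n : ℕ) : oddSign n * oddSign n = 1 := by
  unfold oddSign; split_ifs <;> rfl

/-- For even `n`, `ν` contains at least the power of 7 in `n`, so an extra factor 7 does not enlarge
the gcd. -/
lemma gcd_muSeq_mul {n ν : ℕ} (hn : n ≠ 0) (hν : (ν : ℤ) = nuInt n) :
    Nat.gcd (muSeq n * ν) n = Nat.gcd n ν := by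
  by_cases he : Even n
  · rw [show muSeq n = 7 by simp [muSeq, he]]
    obtain ⟨k, m, hm, rfl⟩ := Nat.exists_eq_pow_mul_and_not_dvd hn 7 (by norm_num)
    have hme : Even m := by
      rcases Nat.even_mul.1 he with h | h
      · exact absurd h (by simp [Nat.even_pow, show ¬ Even 7 by decide])
      · exact h
    have h7 : 7 ^ k ∣ ν := by
      have := seven_pow_dvd_nuInt hme k
      rw [← hν] at this
      exact_mod_cast this
    obtain ⟨t, rfl⟩ := h7
    have hcop : Nat.Coprime 7 m := (Nat.Prime.coprime_iff_not_dvd (by norm_num)).2 hm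
    rw [show 7 * (7 ^ k * t) = 7 ^ k * (7 * t) by ring, Nat.gcd_mul_left, Nat.gcd_mul_left,
      Nat.gcd_comm, Nat.Coprime.gcd_mul_left_cancel_right _ hcop]
  · rw [show muSeq n = 1 by simp [muSeq, he], one_mul, Nat.gcd_comm]

lemma three_dvd_muSeq_sub_one (n : ℕ) : (3 : ℤ) ∣ muSeq n - 1 := by
  unfold muSeq; split_ifs <;> norm_num

/-- Away from 3, `3c + ρ = ±n` lets `c` be traded for `n`. If `3 ∣ n`, then `3^(k+1)`, the exact
power of 3 in `n`, divides `ν`, while `c` carries exactly `3^k`; so precisely one factor 3 is lost.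
-/
lemma gcd_mul_gcd_three {n ν : ℕ} {c : ℤ} (hn : n ≠ 0) (hν : (ν : ℤ) = nuInt n)
    (hc : 3 * c + muSeq n * ν = oddSign n * n) :
    Int.gcd (muSeq n * ν : ℕ) c * Nat.gcd n 3 = Nat.gcd n ν := by
  rw [← gcd_muSeq_mul hn hν]
  have hsq := oddSign_mul_self n
  have hp3 : Prime (3 : ℤ) := Int.prime_three
  by_cases h3 : 3 ∣ n
  · obtain ⟨k, m, hm, rfl⟩ := Nat.exists_eq_pow_mul_and_not_dvd hn 3 (by norm_num)
    obtain ⟨k, rfl⟩ : ∃ j, k = j + 1 := by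
      rcases k with _ | k
      · simp at h3; exact absurd h3 hm
      · exact ⟨k, rfl⟩
    have hs : oddSign (3 ^ (k + 1) * m) = oddSign m := oddSign_odd_mul (Odd.pow (by decide)) m
    obtain ⟨t, ht, b, hb⟩ := nuInt_three_pow m k hm
    obtain ⟨a, ha⟩ := three_dvd_muSeq_sub_one (3 ^ (k + 1) * m)
    rw [Nat.gcd_eq_right h3]
    rw [hs] at hc hsq
    rw [← hν] at ht
    generalize muSeq (3 ^ (k + 1) * m) = μ at *
    generalize oddSign m = s at *
    have ht0 : 0 ≤ t := by
      have : (0 : ℤ) ≤ 3 ^ (k + 1) * t := by rw [← ht]; positivity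
      exact nonneg_of_mul_nonneg_right this (by positivity)
    lift t to ℕ using ht0
    obtain rfl : ν = 3 ^ (k + 1) * t := by exact_mod_cast ht
    obtain rfl : c = 3 ^ k * (s * m - μ * t) := by
      push_cast at hc
      have : 3 * c = 3 * (3 ^ k * (s * m - μ * t)) := by linear_combination hc
      linarith
    have hmz : ¬ (3 : ℤ) ∣ m := by exact_mod_cast hm
    have hw : ¬ (3 : ℤ) ∣ s * m - μ * t := by
      intro h
      have h1 : (3 : ℤ) ∣ s * m := by
        obtain ⟨w, hw⟩ := h
        exact ⟨-(w + b + a * t), by linear_combination -hw - hb - t * ha⟩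
      rcases hp3.dvd_or_dvd h1 with h2 | h2
      · have : (3 : ℤ) ∣ 1 := hsq ▸ h2.mul_right s
        norm_num at this
      · exact hmz h2
    rw [show μ * (3 ^ (k + 1) * t) = 3 ^ (k + 1) * (μ * t) by ring, Nat.gcd_mul_left,
      show ((3 ^ (k + 1) * (μ * t) : ℕ) : ℤ) = 3 ^ k * (3 * (μ * t : ℕ)) by push_cast; ring,
      Int.gcd_mul_left, Int.natAbs_pow]
    have key : Int.gcd (3 * (μ * t : ℕ)) (s * m - μ * t) = Nat.gcd (μ * t) m := by
      apply Nat.dvd_antisymm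
      · have h1 := Int.gcd_dvd_left (3 * (μ * t : ℕ)) (s * m - μ * t)
        have h2 := Int.gcd_dvd_right (3 * (μ * t : ℕ)) (s * m - μ * t)
        generalize Int.gcd (3 * (μ * t : ℕ)) (s * m - μ * t) = D at *
        have hD : IsCoprime (D : ℤ) 3 :=
          ((Prime.coprime_iff_not_dvd hp3).2 fun h => hw (h.trans h2)).symm
        have h3 : (D : ℤ) ∣ (μ * t : ℕ) := hD.dvd_of_dvd_mul_left h1
        refine Nat.dvd_gcd (by exact_mod_cast h3) ?_
        have h4 : (D : ℤ) ∣ s * (s * m) := by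
          have := dvd_add h2 h3
          push_cast at this
          rw [sub_add_cancel] at this
          exact this.mul_left s
        rw [← mul_assoc, hsq, one_mul] at h4
        exact_mod_cast h4
      · apply Int.dvd_gcd
        · exact (Int.natCast_dvd_natCast.2 (Nat.gcd_dvd_left _ _)).mul_left 3
        · refine dvd_sub ((Int.natCast_dvd_natCast.2 (Nat.gcd_dvd_right _ _)).mul_left s) ?_
          exact_mod_cast Int.natCast_dvd_natCast.2 (Nat.gcd_dvd_left _ _)
    rw [key]
    rw [show (3 : ℤ).natAbs = 3 from rfl]
    ring
  · have hc3 : Nat.Coprime n 3 := ((Nat.Prime.coprime_iff_not_dvd (by norm_num)).2 h3).symm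
    rw [hc3.gcd_eq_one, mul_one]
    apply Nat.dvd_antisymm
    · have h1 := Int.gcd_dvd_left (muSeq n * ν : ℕ) c
      have h2 := Int.gcd_dvd_right (muSeq n * ν : ℕ) c
      refine Nat.dvd_gcd (by exact_mod_cast h1) ?_
      have h4 := (dvd_add (h2.mul_left 3) h1).mul_left (oddSign n)
      push_cast at h4
      rw [hc, ← mul_assoc, hsq, one_mul] at h4
      exact_mod_cast h4
    · apply Int.dvd_gcd
      · exact Int.natCast_dvd_natCast.2 (Nat.gcd_dvd_left _ _)
      · have h1 : ((Nat.gcd (muSeq n * ν) n : ℕ) : ℤ) ∣ (muSeq n * ν : ℕ) :=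
          Int.natCast_dvd_natCast.2 (Nat.gcd_dvd_left _ _)
        have h2 : ((Nat.gcd (muSeq n * ν) n : ℕ) : ℤ) ∣ (n : ℕ) :=
          Int.natCast_dvd_natCast.2 (Nat.gcd_dvd_right _ _)
        have hcop : IsCoprime ((Nat.gcd (muSeq n * ν) n : ℕ) : ℤ) 3 :=
          Nat.isCoprime_iff_coprime.2 (hc3.coprime_dvd_left (Nat.gcd_dvd_right _ _))
        refine hcop.dvd_of_dvd_mul_left ?_
        have := dvd_sub (h2.mul_left (oddSign n)) h1
        push_cast at this
        rwa [← hc, add_sub_cancel_right] at this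

/-- A factor coprime to both orders may be moved between two cyclic groups. -/
lemma nonempty_zmod_prod_swap {k a b : ℕ} (ha : Nat.Coprime k a) (hb : Nat.Coprime k b) :
    Nonempty (ZMod (k * a) × ZMod b ≃+ ZMod a × ZMod (k * b)) := by
  let e1 := (ZMod.chineseRemainder ha).toAddEquiv
  let e2 := (ZMod.chineseRemainder hb).toAddEquiv
  exact ⟨(e1.prodCongr (AddEquiv.refl _)).trans ((AddEquiv.prodComm.prodCongr
    (AddEquiv.refl _)).trans (AddEquiv.prodAssoc.trans ((AddEquiv.refl _).prodCongr e2.symm)))⟩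

end Arithmetic

/-! ### Assembly -/

theorem theorem2 (n : ℕ) [NeZero n] (hn : 3 ≤ n) :
    Nonempty (deltaGraph n 1 1 1 ≃g
      SimpleGraph.boxProd (SimpleGraph.cycleGraph 3) (SimpleGraph.cycleGraph n)) ∧
    ∃ ν : ℕ, 0 < ν ∧ (ν : ℂ) = nuFun n ∧
      Nat.gcd n 3 ∣ Nat.gcd n ν ∧
      Nonempty (jacobianGroup (deltaGraph n 1 1 1) ≃+
        ZMod (Nat.gcd n ν / Nat.gcd n 3) × (ZMod ν × ZMod ν) ×
          ZMod (muHat n * ν) × ZMod (3 * muSeq n * Nat.lcm n ν)) := by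
  refine ⟨deltaGraph_one_iso hn, ?_⟩
  have hn0 : n ≠ 0 := by omega
  have hpos := nuInt_pos (n := n) (by omega)
  obtain ⟨ν, hν⟩ := Int.eq_ofNat_of_zero_le hpos.le
  obtain ⟨c, hc, hquad, hcub⟩ := exists_lattice_data n (by omega)
  rw [hν] at hpos hc hquad hcub
  have hν0 : 0 < ν := by exact_mod_cast hpos
  have hmu : 0 < muSeq n := by unfold muSeq; split_ifs <;> norm_num
  have hg := gcd_mul_gcd_three hn0 hν.symm hc
  refine ⟨ν, hν0, by rw [← nuInt_eq_nuFun, hν]; simp, Dvd.intro_left _ hg, ?_⟩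
  set d := Int.gcd (muSeq n * ν : ℕ) c with hd
  have hg3 : 0 < Nat.gcd n 3 := Nat.gcd_pos_of_pos_left _ (by omega)
  rw [← hg, Nat.mul_div_cancel _ hg3]
  have hd0 : 0 < d := Int.gcd_pos_of_ne_zero_left _ (by positivity)
  obtain ⟨r, hr⟩ : d ∣ muSeq n * ν := by
    exact_mod_cast Int.gcd_dvd_left (muSeq n * ν : ℕ) c
  obtain ⟨c', hc'⟩ : (d : ℤ) ∣ c := Int.gcd_dvd_right _ _
  have hr0 : r ≠ 0 := by
    rintro rfl
    rw [mul_zero] at hr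
    have := Nat.mul_pos hmu hν0
    omega
  have huv : Int.gcdA (muSeq n * ν : ℕ) c * r + Int.gcdB (muSeq n * ν : ℕ) c * c' = 1 := by
    have h := Int.gcd_eq_gcd_ab (muSeq n * ν : ℕ) c
    rw [← hd] at h
    have hd' : (d : ℤ) ≠ 0 := by exact_mod_cast hd0.ne'
    apply mul_left_cancel₀ hd'
    have hr' : ((muSeq n * ν : ℕ) : ℤ) = d * r := by exact_mod_cast hr
    linear_combination -h - Int.gcdA (muSeq n * ν : ℕ) c * hr' - Int.gcdB (muSeq n * ν : ℕ) c * hc'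
  have hdn : d ∣ n := (Dvd.intro _ hg).trans (Nat.gcd_dvd_left _ _)
  have hrn : r * n = muSeq n * (Nat.gcd n 3 * Nat.lcm n ν) := by
    apply Nat.eq_of_mul_eq_mul_left hd0
    have h1 := Nat.gcd_mul_lcm n ν
    rw [← hg] at h1
    calc d * (r * n) = muSeq n * (n * ν) := by rw [← mul_assoc, ← hr]; ring
      _ = _ := by rw [← h1]; ring
  obtain ⟨e⟩ := nonempty_laplacianCoker_addEquiv hn (ρ := muSeq n * ν)
    (by push_cast; exact hquad) (by push_cast; exact hcub) hr hc' hdn huv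
  -- If `3 ∣ n` the orders already agree; otherwise 3 is prime to `n` and `μν`, so it can pass from
  -- one cyclic factor to the other.
  have swap : Nonempty (ZMod (3 * (muSeq n * ν)) × ZMod (r * n) ≃+
      ZMod (muHat n * ν) × ZMod (3 * muSeq n * Nat.lcm n ν)) := by
    rw [hrn, muHat]
    by_cases h3 : 3 ∣ n
    · rw [Nat.gcd_eq_right h3, show 3 * (muSeq n * ν) = 3 * muSeq n * ν by ring,
        show muSeq n * (3 * Nat.lcm n ν) = 3 * muSeq n * Nat.lcm n ν by ring]
      exact ⟨AddEquiv.refl _⟩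
    · have hp : Nat.Prime 3 := by norm_num
      have hc3 : Nat.Coprime n 3 := ((Nat.Prime.coprime_iff_not_dvd hp).2 h3).symm
      rw [hc3.gcd_eq_one, one_mul, one_mul, mul_assoc 3]
      have hmν : ¬ 3 ∣ muSeq n * ν := by
        intro h
        have h1 : (3 : ℤ) ∣ muSeq n * ν := by exact_mod_cast h
        have h2 := dvd_add (dvd_mul_right 3 c) h1
        rw [hc] at h2
        have h4 := h2.mul_left (oddSign n)
        rw [← mul_assoc, oddSign_mul_self, one_mul] at h4
        exact h3 (by exact_mod_cast h4)
      refine nonempty_zmod_prod_swap (hp.coprime_iff_not_dvd.2 hmν) (hp.coprime_iff_not_dvd.2 ?_)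
      intro h
      have h1 : 3 ∣ muSeq n * (n * ν) := h.trans (mul_dvd_mul_left _ (Nat.lcm_dvd_mul n ν))
      rw [show muSeq n * (n * ν) = n * (muSeq n * ν) by ring] at h1
      exact (hp.dvd_mul.1 h1).elim h3 hmν
  obtain ⟨E⟩ := swap
  have : NeZero ν := ⟨hν0.ne'⟩
  have : NeZero (3 * (muSeq n * ν)) := ⟨by positivity⟩
  have : NeZero d := ⟨hd0.ne'⟩
  have : NeZero (r * n) := ⟨Nat.mul_ne_zero hr0 hn0⟩
  obtain ⟨T⟩ := nonempty_torsion_addEquiv e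
  refine ⟨T.trans ?_⟩
  exact
    { toFun := fun x => (x.2.2.2.1, (x.1, x.2.2.1), E (x.2.1, x.2.2.2.2))
      invFun := fun x => (x.2.1.1, (E.symm x.2.2).1, x.2.1.2, x.1, (E.symm x.2.2).2)
      left_inv := fun x => by simp
      right_inv := fun x => by simp
      map_add' := fun x y => by
        simp only [Prod.fst_add, Prod.snd_add, ← Prod.mk_add_mk, map_add] }
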